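/- Let $H_n=\mathbb C^n\times\mathbb R$ be the Heisenberg group with coordinates $(z,t)$, $z_\beta=x_\beta+iy_\beta$, contact form $\Theta=dt+\sum_\beta(x_\beta dy_\beta-y_\beta dx_\beta)$, contact bundle $\xi=\ker\Theta$, left invariant frame $\mathring e_\beta=\partial_{x_\beta}+y_\beta\partial_t$, $\mathring e_{n+\beta}=\partial_{y_\beta}-x_\beta\partial_t$, $T=\partial_t$, and complex structure $J\mathring e_\beta=\mathring e_{n+\beta}$, $J\mathring e_{n+\beta}=-\mathring e_\beta$ on $\xi$. Its pseudohermitian connection $\nabla$ is the one for which this frame is parallel. Let $(M^{2m+1},\hat J,\hat\theta)$, $m\ge 1$, be a (strictly pseudoconvex) pseudohermitian manifold, smoothly immersed in $H_n$ (for example, embedded) as a pseudohermitian submanifold: $\hat\xi:=\ker\hat\theta=TM\cap\xi$, $\hat J=J|_{\hat\xi}$, $\hat\theta=\Theta|_M$. Its fundamental vector field $\nu$ is the section of $\xi$ along $M$ that is orthogonal to $\hat\xi$ and for which $T+\nu$ is tangent to $M$. Suppose that $M$ is vertical, that is, $\nu\equiv 0$. Then the Reeb field $\hat T$ of $\hat\theta$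 and the pseudohermitian (Tanaka--Webster) connection $\hat\nabla$ of $(M,\hat J,\hat\theta)$ exist, and: (1) the Webster torsion $v\mapsto \mathrm{Tor}_{\hat\nabla}(\hat T,v)$ vanishes identically; (2) on $\hat\xi$, $\hat\nabla$ coincides with the tangential connection $\nabla^t$, the orthogonal projection of $\nabla$ to $\hat\xi$; (3) let $Z_1,\dots,Z_n$ be a Darboux frame, that is, a unitary frame of $\xi_{1,0}$ along $M$ (for the Levi form $-i\,d\Theta(Z,\overline W)$) with $Z_1,\dots,Z_m$ tangent to $M$, and let $h^c_{jk}$, $1\le j,k\le m<c\le n$, be the $Z_c$-component of $\nabla_{Z_k}Z_j$ (the second fundamental form). Then the Webster curvature $R_{j\bar l\zeta\bar\eta}=\langle \hat R(Z_\zeta,Z_{\bar\eta})Z_j,Z_l\rangle$ satisfies the Gauss-like equation $$R_{j\bar l\zeta\bar\eta}=-\sum_{c=m+1}^n h^c_{j\zeta}\,\overline{h^c_{l\eta}},$$ and hence the Webster--Ricci tensor $R_{\zeta\bar\eta}=\sum_{k=1}^m R_{k\bar k\zeta\bar\eta}$ is $$R_{\zeta\bar\eta}=-\sum_{c=m+1}^n\sum_{k=1}^m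 h^c_{k\zeta}\,\overline{h^c_{k\eta}};$$ (4) the Webster--Ricci tensor is non-positive: $R_{Z\bar Z}$ is real and $\le 0$ for every $(1,0)$-vector $Z$ on $M$. -/

import Mathlib

open scoped Manifold ContDiff InnerProductSpace

noncomputable section

/-! ### The Heisenberg group -/

/-- The underlying manifold `ℂⁿ × ℝ` of the Heisenberg group `H_n`, with points `(z, t)`,
`z_β = x_β + i y_β`.  All tangent spaces are identified with `ℂⁿ × ℝ`. -/
abbrev Heis (n : ℕ) : Type := EuclideanSpace ℂ (Fin n) × ℝ

namespace Heis

variable {n : ℕ}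

/-- The contact form `Θ = dt + ∑ (x_β dy_β - y_β dx_β)` at `q = (z, t)`, applied to
`v = (w, s)`; note that `Im (conj z_β * w_β) = x_β Im w_β - y_β Re w_β`. -/
def contactForm (q v : Heis n) : ℝ :=
  v.2 + ∑ β, ((q.1 β).re * (v.1 β).im - (q.1 β).im * (v.1 β).re)

/-- The tangent vector at `q` whose coefficients in the left invariant frame are `c`:
`∑ Re (c_β) e_β + Im (c_β) e_{n+β} + c₀ T`, where `e_β = ∂/∂x_β + y_β ∂/∂t`,
`e_{n+β} = ∂/∂y_β - x_β ∂/∂t`, `T = ∂/∂t`, `c = ((c_β), c₀)`. -/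
def frame (q c : Heis n) : Heis n :=
  (c.1, c.2 + ∑ β, ((c.1 β).re * (q.1 β).im - (c.1 β).im * (q.1 β).re))

/-- The coefficients of a tangent vector `v` at `q` in the left invariant frame
(the inverse of `Heis.frame q`). -/
def coeff (q v : Heis n) : Heis n := (v.1, contactForm q v)

lemma frame_coeff (q v : Heis n) : frame q (coeff q v) = v := by
  refine Prod.ext rfl ?_
  simp only [frame, coeff, contactForm, add_assoc, ← Finset.sum_add_distrib]
  rw [Finset.sum_eq_zero, add_zero]
  intros
  ring

lemma coeff_frame (q c : Heis n) : coeff q (frame q c) = c := by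
  refine Prod.ext rfl ?_
  simp only [frame, coeff, contactForm, add_assoc, ← Finset.sum_add_distrib]
  rw [Finset.sum_eq_zero, add_zero]
  intros
  ring

/-- The complex structure `J` of the contact bundle `ξ = ker Θ` (extended by `J T = 0`):
`J e_β = e_{n+β}`, `J e_{n+β} = - e_β`. -/
def J (q v : Heis n) : Heis n := frame q (Complex.I • v.1, 0)

/-- The characteristic vector field `T = ∂/∂t`. -/
def T (n : ℕ) : Heis n := (0, 1)

/-- The adapted inner product on the contact space at `q`, for which the `e_β`, `e_{n+β}` are
orthonormal (it is one half of the Levi metric `dΘ(·, J ·)`). -/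
def contactInner (v w : Heis n) : ℝ := ⟪v.1, w.1⟫_ℝ

end Heis

/-! ### Pseudohermitian manifolds -/

section Pseudohermitian

/-- The model space of a manifold of dimension `2m+1`. -/
abbrev CRModel (m : ℕ) : Type := EuclideanSpace ℝ (Fin (2 * m + 1))

variable {m : ℕ} {M : Type*} [TopologicalSpace M] [ChartedSpace (CRModel m) M]
  [IsManifold (𝓡 (2 * m + 1)) ∞ M]

/-- Vector fields on `M` (not necessarily smooth). -/
abbrev VField (m : ℕ) (M : Type*) [TopologicalSpace M] [ChartedSpace (CRModel m) M] : Type _ :=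
  (p : M) → TangentSpace (𝓡 (2 * m + 1)) p

/-- Smooth vector fields. -/
def IsSmoothField (X : VField m M) : Prop :=
  ContMDiff (𝓡 (2 * m + 1)) (𝓡 (2 * m + 1)).tangent ∞
    (fun p ↦ (⟨p, X p⟩ : TangentBundle (𝓡 (2 * m + 1)) M))

/-- The derivative `v f` of a function in the direction of a tangent vector. -/
def dirDeriv (f : M → ℝ) (p : M) (v : TangentSpace (𝓡 (2 * m + 1)) p) : ℝ :=
  mfderiv (𝓡 (2 * m + 1)) 𝓘(ℝ, ℝ) f p v

/-- The exterior derivative of a one form: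
`dθ(X, Y) = X θ(Y) - Y θ(X) - θ([X, Y])`. -/
def extd (θ : (p : M) → TangentSpace (𝓡 (2 * m + 1)) p →L[ℝ] ℝ) (X Y : VField m M) (p : M) : ℝ :=
  dirDeriv (fun q ↦ θ q (Y q)) p (X p) - dirDeriv (fun q ↦ θ q (X q)) p (Y p)
    - θ p (VectorField.mlieBracket (𝓡 (2 * m + 1)) X Y p)

variable (m M) in
/-- A (strictly pseudoconvex) pseudohermitian structure `(J, θ)` on a manifold of dimension
`2m+1`. Only the restriction of `J` to the contact bundle `ker θ` is part of the structure;
the values of `J` outside `ker θ` are never used. -/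
structure PseudohermitianStructure where
  /-- the contact form -/
  θ : (p : M) → TangentSpace (𝓡 (2 * m + 1)) p →L[ℝ] ℝ
  /-- the complex structure of the contact bundle -/
  J : (p : M) → TangentSpace (𝓡 (2 * m + 1)) p →L[ℝ] TangentSpace (𝓡 (2 * m + 1)) p
  θ_ne_zero : ∀ p, θ p ≠ 0
  smooth_θ : ∀ X : VField m M, IsSmoothField X →
    ContMDiff (𝓡 (2 * m + 1)) 𝓘(ℝ, ℝ) ∞ (fun p ↦ θ p (X p))
  J_mem : ∀ p v, θ p v = 0 → θ p (J p v) = 0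
  J_sq : ∀ p v, θ p v = 0 → J p (J p v) = -v
  smooth_J : ∀ X : VField m M, IsSmoothField X → (∀ p, θ p (X p) = 0) →
    IsSmoothField (fun p ↦ J p (X p))
  /-- the Levi form is positive definite; in particular `θ` is a contact form -/
  levi_pos : ∀ X : VField m M, IsSmoothField X → (∀ p, θ p (X p) = 0) →
    ∀ p, X p ≠ 0 → 0 < extd θ X (fun q ↦ J q (X q)) p
  /-- integrability of `J`: the bracket `[X, Y] - [JX, JY]` is horizontal -/
  bracket_mem : ∀ X Y : VField m M, IsSmoothField X → IsSmoothField Y →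
    (∀ p, θ p (X p) = 0) → (∀ p, θ p (Y p) = 0) → ∀ p,
    θ p (VectorField.mlieBracket (𝓡 (2 * m + 1)) X Y p
      - VectorField.mlieBracket (𝓡 (2 * m + 1)) (fun q ↦ J q (X q)) (fun q ↦ J q (Y q)) p) = 0
  /-- integrability of `J`: `J ([X, Y] - [JX, JY]) = [JX, Y] + [X, JY]` -/
  integrable : ∀ X Y : VField m M, IsSmoothField X → IsSmoothField Y →
    (∀ p, θ p (X p) = 0) → (∀ p, θ p (Y p) = 0) → ∀ p,
    J p (VectorField.mlieBracket (𝓡 (2 * m + 1)) X Y p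
      - VectorField.mlieBracket (𝓡 (2 * m + 1)) (fun q ↦ J q (X q)) (fun q ↦ J q (Y q)) p)
    = VectorField.mlieBracket (𝓡 (2 * m + 1)) (fun q ↦ J q (X q)) Y p
      + VectorField.mlieBracket (𝓡 (2 * m + 1)) X (fun q ↦ J q (Y q)) p

/-- Affine connections on `M`; `D Y p v` is `∇_v Y` at the point `p`. -/
abbrev AffineConnection (m : ℕ) (M : Type*) [TopologicalSpace M] [ChartedSpace (CRModel m) M]
    [IsManifold (𝓡 (2 * m + 1)) ∞ M] : Type _ :=
  CovariantDerivative (𝓡 (2 * m + 1)) (CRModel m)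
    (TangentSpace (𝓡 (2 * m + 1)) : M → Type _)

/-- The curvature `R(X, Y) V = ∇_X ∇_Y V - ∇_Y ∇_X V - ∇_{[X, Y]} V`. -/
def curvature (D : AffineConnection m M)
    (X Y V : VField m M) : VField m M := fun p ↦
  D (fun q ↦ D V q (Y q)) p (X p) - D (fun q ↦ D V q (X q)) p (Y p)
    - D V p (VectorField.mlieBracket (𝓡 (2 * m + 1)) X Y p)

namespace PseudohermitianStructure

variable (S : PseudohermitianStructure m M)

/-- Sections of the contact bundle `ker θ`. -/
def IsHorizontal (X : VField m M) : Prop := ∀ p, S.θ p (X p) = 0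

/-- The vector field `J X`. -/
def JField (X : VField m M) : VField m M := fun p ↦ S.J p (X p)

/-- `T` is the Reeb field of `θ`: `θ(T) = 1` and `dθ(T, ·) = 0`. -/
structure IsReebField (T : VField m M) : Prop where
  smooth : IsSmoothField T
  θ_eq_one : ∀ p, S.θ p (T p) = 1
  extd_eq_zero : ∀ X : VField m M, IsSmoothField X → ∀ p, extd S.θ T X p = 0

/-- The hermitian Levi form `-i dθ(Z_V, conj Z_W) = (dθ(V, JW) - i dθ(V, W)) / 2` of the
`(1,0)`-fields `Z_V = (V - i JV) / 2`, `Z_W = (W - i JW) / 2`, for horizontal `V` and `W`. -/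
def levi (V W : VField m M) (p : M) : ℂ :=
  ((extd S.θ V (S.JField W) p : ℂ) - Complex.I * (extd S.θ V W p : ℂ)) / 2

/-- The `m` vectors `Z_j = (E_j - i J E_j) / 2` form a unitary basis of the
`(1,0)`-vectors at `p`, for the Levi form. -/
structure IsUnitaryFrameAt (p : M) (E : Fin m → VField m M) : Prop where
  smooth : ∀ j, IsSmoothField (E j)
  horizontal : ∀ j, S.IsHorizontal (E j)
  unitary : ∀ j k, S.levi (E j) (E k) p = if j = k then 1 else 0

/-- `D` is the pseudohermitian (Tanaka-Webster) connection of `(M, J, θ)`, where `T` is the Reeb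
field: the contact bundle, `T`, `J` and `dθ` are parallel, the torsion of two horizontal vectors
is `dθ(X, Y) T`, and `X ↦ Tor(T, X)` anticommutes with `J`. -/
structure IsPseudohermitianConnection (T : VField m M) (D : AffineConnection m M) : Prop where
  smooth : ∀ X Y : VField m M, IsSmoothField X → IsSmoothField Y →
    IsSmoothField (fun p ↦ D Y p (X p))
  horizontal : ∀ Y : VField m M, IsSmoothField Y → S.IsHorizontal Y →
    ∀ p v, S.θ p (D Y p v) = 0
  reeb_parallel : ∀ p v, D T p v = 0
  J_parallel : ∀ Y : VField m M, IsSmoothField Y → S.IsHorizontal Y →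
    ∀ p v, D (S.JField Y) p v = S.J p (D Y p v)
  metric : ∀ X Y Z : VField m M, IsSmoothField X → IsSmoothField Y → IsSmoothField Z →
    S.IsHorizontal Y → S.IsHorizontal Z → ∀ p,
    dirDeriv (fun q ↦ extd S.θ Y Z q) p (X p)
      = extd S.θ (fun q ↦ D Y q (X q)) Z p + extd S.θ Y (fun q ↦ D Z q (X q)) p
  torsion_horizontal : ∀ X Y : VField m M, IsSmoothField X → IsSmoothField Y →
    S.IsHorizontal X → S.IsHorizontal Y → ∀ p,
    D.torsion p (X p) (Y p) = extd S.θ X Y p • T p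
  torsion_reeb : ∀ p v, S.θ p v = 0 →
    D.torsion p (T p) (S.J p v) = - S.J p (D.torsion p (T p) v)

/-- The Webster curvature `R_{V \bar W X \bar Y} = ⟨R(Z_X, conj Z_Y) Z_V, Z_W⟩`, where
`Z_X = (X - i JX) / 2` and `conj Z_Y = (Y + i JY) / 2`: it is the complex bilinear extension in
the first two slots of `(X, Y) ↦ ⟨R(X, Y) V, W⟩`, evaluated at these complex vectors. -/
def websterCurvature (D : AffineConnection m M) (V W X Y : VField m M) (p : M) : ℂ :=
  (S.levi (curvature D X Y V) W p + S.levi (curvature D (S.JField X) (S.JField Y) V) W p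
    + Complex.I * (S.levi (curvature D X (S.JField Y) V) W p
      - S.levi (curvature D (S.JField X) Y V) W p)) / 4

/-- The Webster-Ricci tensor `R_{X \bar Y} = ∑_k R_{k \bar k X \bar Y}`, computed in a frame `E`
that is unitary at `p`. -/
def websterRicci (D : AffineConnection m M) (E : Fin m → VField m M) (X Y : VField m M)
    (p : M) : ℂ :=
  ∑ k, S.websterCurvature D (E k) (E k) X Y p

end PseudohermitianStructure

/-! ### Pseudohermitian submanifolds of the Heisenberg group -/

variable {n : ℕ}

/-- The differential of `ι : M → H_n`. -/
def pushforward (ι : M → Heis n) (p : M) : TangentSpace (𝓡 (2 * m + 1)) p →L[ℝ] Heis n :=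
  mfderiv (𝓡 (2 * m + 1)) 𝓘(ℝ, Heis n) ι p

namespace PseudohermitianStructure

variable (S : PseudohermitianStructure m M)

/-- `ι` makes `(M, J, θ)` a pseudohermitian submanifold of `H_n`. -/
structure IsPseudohermitianSubmanifold (ι : M → Heis n) : Prop where
  smooth : ContMDiff (𝓡 (2 * m + 1)) 𝓘(ℝ, Heis n) ∞ ι
  immersion : ∀ p, Function.Injective (pushforward (m := m) ι p)
  contact : ∀ p v, S.θ p v = 0 ↔ Heis.contactForm (ι p) (pushforward ι p v) = 0
  complex : ∀ p v, S.θ p v = 0 →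
    pushforward ι p (S.J p v) = Heis.J (ι p) (pushforward ι p v)
  form : ∀ p v, S.θ p v = Heis.contactForm (ι p) (pushforward ι p v)

/-- `ν` is the fundamental vector field: the horizontal field of `H_n` along `M` that is
orthogonal to the contact bundle of `M` and for which `T + ν` is tangent to `M`. -/
structure IsFundamentalVectorField (ι : M → Heis n) (ν : M → Heis n) : Prop where
  horizontal : ∀ p, Heis.contactForm (ι p) (ν p) = 0
  orthogonal : ∀ p v, S.θ p v = 0 → Heis.contactInner (pushforward ι p v) (ν p) = 0
  tangent : ∀ p, ∃ v : TangentSpace (𝓡 (2 * m + 1)) p, pushforward ι p v = Heis.T n + ν p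

/-- The submanifold is vertical if its fundamental vector field vanishes identically. -/
def IsVertical (ι : M → Heis n) : Prop := S.IsFundamentalVectorField ι (fun _ ↦ 0)

end PseudohermitianStructure

/-- The pseudohermitian connection of `H_n`, for a vector field `W` of `H_n` along `ι`. It is the
connection for which the left invariant frame `e_β`, `e_{n+β}`, `T` is parallel. -/
def heisDeriv (ι : M → Heis n) (W : M → Heis n) (p : M)
    (v : TangentSpace (𝓡 (2 * m + 1)) p) : Heis n :=
  Heis.frame (ι p)
    (mfderiv (𝓡 (2 * m + 1)) 𝓘(ℝ, Heis n) (fun q ↦ Heis.coeff (ι q) (W q)) p v : Heis n)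

namespace PseudohermitianStructure

variable (S : PseudohermitianStructure m M)

/-- The image of the contact space of `M` at `p` under the differential of `ι`, in the
coefficients `ℂⁿ` of the contact space of `H_n` with respect to the left invariant frame. -/
def contactSubspace (ι : M → Heis n) (p : M) : Submodule ℝ (EuclideanSpace ℂ (Fin n)) :=
  (LinearMap.ker (S.θ p : TangentSpace (𝓡 (2 * m + 1)) p →ₗ[ℝ] ℝ)).map
    ((LinearMap.fst ℝ (EuclideanSpace ℂ (Fin n)) ℝ).comp
      (pushforward (m := m) ι p).toLinearMap)

/-- The tangential connection on the contact bundle of `M`, with values in the contact bundle of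
`M` regarded as a subbundle of that of `H_n`: the orthogonal projection of the pseudohermitian
derivative in `H_n` onto the contact space of `M`. -/
def tangentialDeriv (ι : M → Heis n) (Y : VField m M) (p : M)
    (v : TangentSpace (𝓡 (2 * m + 1)) p) : Heis n :=
  Heis.frame (ι p)
    ((S.contactSubspace ι p).starProjection
      (heisDeriv ι (fun q ↦ pushforward ι q (Y q)) p v).1, 0)

/-- A Darboux frame at `p`: the vectors `Z_j = (E_j - i J E_j) / 2`, `j = 1, …, m`, tangent to
`M`, together with the normal vectors `Z_a = ∑_β N_a^β (e_β - i e_{n+β}) / 2`,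
`a = m+1, …, n`, form a unitary basis of the `(1,0)`-vectors of `H_n`. -/
structure IsDarbouxFrameAt (ι : M → Heis n) (p : M) (E : Fin m → VField m M)
    (N : Fin (n - m) → EuclideanSpace ℂ (Fin n)) : Prop where
  smooth : ∀ j, IsSmoothField (E j)
  horizontal : ∀ j, S.IsHorizontal (E j)
  unitary : Orthonormal ℂ (Sum.elim (fun j ↦ (pushforward ι p (E j p)).1) N)

/-- The value at `v` of the connection form `θ_j^a` of `H_n`: the coefficient of `Z_a` in
`∇_v Z_j`, where `Z_j = (X - i JX) / 2`. -/
def connectionForm (ι : M → Heis n) (Na : EuclideanSpace ℂ (Fin n)) (X : VField m M) (p : M)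
    (v : TangentSpace (𝓡 (2 * m + 1)) p) : ℂ :=
  ⟪Na, (heisDeriv ι (fun q ↦ pushforward ι q (X q)) p v).1⟫_ℂ

/-- The coefficient `h^a_{jk} = II^a(Z_j, Z_k) = θ_j^a(Z_k)` of the second fundamental form, for
`Z_j = (X - i JX) / 2` and `Z_k = (Y - i JY) / 2`. -/
def secondFundamentalForm (ι : M → Heis n) (Na : EuclideanSpace ℂ (Fin n)) (X Y : VField m M)
    (p : M) : ℂ :=
  (connectionForm ι Na X p (Y p)
    - Complex.I * connectionForm ι Na X p (S.J p (Y p))) / 2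

end PseudohermitianStructure

end Pseudohermitian

end

/-! For a vertical submanifold `∂/∂t` is the Reeb direction, and the projection `φ : M → ℂⁿ` of the
immersion is holomorphic and immersive on the contact bundle, with `dθ = 2 Im ⟪dφ, dφ⟫`. Orthogonal
projection of the flat derivative of `dφ` therefore gives a connection that is pseudohermitian with
torsion `dθ ⊗ T`, and uniqueness of the Tanaka-Webster connection identifies the two. The curvature
is given by the Gauss equation for `φ` in flat space; the second fundamental form is complex
bilinear, so of the two Gauss terms only the one pairing `II(Z_j, Z_ζ)` with `II(Z_l, Z_η)`
contributes to `R_{j \bar l ζ \bar η}`. -/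

section ManifoldCalculus

open Bundle VectorField

variable {E : Type*} [NormedAddCommGroup E] [NormedSpace ℝ E]
  {H : Type*} [TopologicalSpace H] {I : ModelWithCorners ℝ E H}
  {M : Type*} [TopologicalSpace M] [ChartedSpace H M]
  {F F' : Type*} [NormedAddCommGroup F] [NormedSpace ℝ F]
  [NormedAddCommGroup F'] [NormedSpace ℝ F']
  {V : Type*} [NormedAddCommGroup V] [InnerProductSpace ℂ V] [NormedSpace ℝ V]

lemma mvfderiv_comp_apply_of_hasFDerivAt {g : F → F'} {g' : F →L[ℝ] F'} {f : M → F} {p : M}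
    (hg : HasFDerivAt g g' (f p)) (hf : MDifferentiableAt I 𝓘(ℝ, F) f p) (v : TangentSpace I p) :
    mvfderiv I (fun q ↦ g (f q)) p v = g' (mvfderiv I f p v) :=
  congrArg (fun A : E →L[ℝ] F' ↦ A v) (hg.hasMFDerivAt.comp p hf.hasMFDerivAt).mfderiv

lemma mdifferentiableAt_complex_inner {f g : M → V} {p : M}
    (hf : MDifferentiableAt I 𝓘(ℝ, V) f p) (hg : MDifferentiableAt I 𝓘(ℝ, V) g p) :
    MDifferentiableAt I 𝓘(ℝ, ℂ) (fun q ↦ ⟪f q, g q⟫_ℂ) p := by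
  have hinner : DifferentiableAt ℝ (fun z : V × V ↦ ⟪z.1, z.2⟫_ℂ) (f p, g p) :=
    differentiableAt_fst.inner ℂ differentiableAt_snd
  exact hinner.mdifferentiableAt.comp p (hf.prodMk_space hg)

lemma contMDiffAt_complex_inner {f g : M → V} {p : M} {k : ℕ∞ω}
    (hf : ContMDiffAt I 𝓘(ℝ, V) k f p) (hg : ContMDiffAt I 𝓘(ℝ, V) k g p) :
    ContMDiffAt I 𝓘(ℝ, ℂ) k (fun q ↦ ⟪f q, g q⟫_ℂ) p :=
  ((contDiff_fst (𝕜 := ℝ)).inner ℂ contDiff_snd).contMDiff.contMDiffAt.comp p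
    (hf.prodMk_space hg)

lemma mvfderiv_complex_inner_apply {f g : M → V} {p : M}
    (hf : MDifferentiableAt I 𝓘(ℝ, V) f p) (hg : MDifferentiableAt I 𝓘(ℝ, V) g p)
    (v : TangentSpace I p) :
    mvfderiv I (fun q ↦ ⟪f q, g q⟫_ℂ) p v
      = ⟪mvfderiv I f p v, g p⟫_ℂ + ⟪f p, mvfderiv I g p v⟫_ℂ := by
  have hinner : HasFDerivAt (fun z : V × V ↦ ⟪z.1, z.2⟫_ℂ) _ (f p, g p) :=
    (hasFDerivAt_fst (𝕜 := ℝ)).inner ℂ hasFDerivAt_snd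
  have hfg : MDifferentiableAt I 𝓘(ℝ, V × V) (fun q ↦ (f q, g q)) p := hf.prodMk_space hg
  have hpair : mvfderiv I (fun q ↦ (f q, g q)) p v = (mvfderiv I f p v, mvfderiv I g p v) :=
    Prod.ext (mvfderiv_comp_apply_of_hasFDerivAt hasFDerivAt_fst hfg v).symm
      (mvfderiv_comp_apply_of_hasFDerivAt hasFDerivAt_snd hfg v).symm
  rw [mvfderiv_comp_apply_of_hasFDerivAt (f := fun q ↦ (f q, g q)) hinner hfg, hpair]
  exact add_comm _ _

/-- The derivative `X f` of a vector valued function along a vector field. -/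
noncomputable def fieldDeriv (X : Π p : M, TangentSpace I p) (f : M → F) (p : M) : F :=
  mvfderiv I f p (X p)

section

variable [IsManifold I ∞ M] {X Y : Π p : M, TangentSpace I p} {f : M → F} {p : M}

lemma contMDiffAt_fieldDeriv (hX : CMDiffAt ∞ (T% X) p) (hf : CMDiff ∞ f) :
    CMDiffAt ∞ (fieldDeriv X f) p :=
  (contMDiff_snd_tangentBundle_modelSpace F 𝓘(ℝ, F)).contMDiffAt.comp p
    ((hf.contMDiff_tangentMap (m := ∞) le_rfl).contMDiffAt.comp p hX)

lemma mdifferentiableAt_fieldDeriv (hX : MDiffAt (T% X) p) (hf : CMDiff ∞ f) :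
    MDiffAt (fieldDeriv X f) p :=
  ((contMDiff_snd_tangentBundle_modelSpace F 𝓘(ℝ, F) (n := ∞)).mdifferentiable
    (by simp) _).comp p
    (((hf.contMDiff_tangentMap (m := ∞) le_rfl).mdifferentiable (by simp) _).comp p hX)

/-- The vector field `X` read in the preferred chart at `p`. -/
noncomputable def fieldInChart (X : Π q : M, TangentSpace I q) (p : M) : E → E :=
  mpullbackWithin 𝓘(ℝ, E) I (extChartAt I p).symm X (Set.range I)

variable [I.Boundaryless]

omit [IsManifold I ∞ M] in
lemma mvfderiv_eq_fderiv_extChartAt (hf : MDiffAt f p) (v : TangentSpace I p) :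
    mvfderiv I f p v = fderiv ℝ (f ∘ (extChartAt I p).symm) (extChartAt I p p) v := by
  have h := hf.mfderiv
  rw [I.range_eq_univ, fderivWithin_univ] at h
  exact congrArg (fun L : E →L[ℝ] F ↦ L v) h

lemma fderiv_fieldInChart {y : E} (hy : y ∈ (extChartAt I p).target)
    (hf : MDiffAt f ((extChartAt I p).symm y)) :
    fderiv ℝ (f ∘ (extChartAt I p).symm) y (fieldInChart X p y)
      = fieldDeriv X f ((extChartAt I p).symm y) := by
  have hψ := mdifferentiableWithinAt_extChartAt_symm hy
  have hcomp := DFunLike.congr_fun (isInvertible_mfderivWithin_extChartAt_symm hy).self_comp_inverse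
    (X ((extChartAt I p).symm y))
  rw [I.range_eq_univ] at hψ hcomp
  rw [mfderivWithin_univ] at hcomp
  have hchain := mfderiv_comp y hf (mdifferentiableWithinAt_univ.1 hψ)
  rw [mfderiv_eq_fderiv] at hchain
  rw [fieldInChart, mpullbackWithin_apply, I.range_eq_univ, mfderivWithin_univ]
  exact (congrArg (fun L : E →L[ℝ] F ↦ L _) hchain).trans
    (congrArg (mvfderiv I f ((extChartAt I p).symm y)) hcomp)

lemma fderiv_fderiv_fieldInChart (hX : MDiffAt (T% X) p) (hf : CMDiff ∞ f) :
    fderiv ℝ (fun y ↦ fderiv ℝ (f ∘ (extChartAt I p).symm) y (fieldInChart X p y))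
      (extChartAt I p p) (fieldInChart Y p (extChartAt I p p))
      = fieldDeriv Y (fieldDeriv X f) p := by
  have hev : (fun y ↦ fderiv ℝ (f ∘ (extChartAt I p).symm) y (fieldInChart X p y))
      =ᶠ[nhds (extChartAt I p p)] (fieldDeriv X f) ∘ (extChartAt I p).symm := by
    filter_upwards [extChartAt_target_mem_nhds p] with y hy
    exact fderiv_fieldInChart hy (hf.mdifferentiable (by simp) _)
  have hXf : MDiffAt (fieldDeriv X f) ((extChartAt I p).symm (extChartAt I p p)) := by
    rw [extChartAt_to_inv]
    exact mdifferentiableAt_fieldDeriv hX hf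
  rw [hev.fderiv_eq, fderiv_fieldInChart (mem_extChartAt_target p) hXf, extChartAt_to_inv]

variable [CompleteSpace E]

lemma differentiableAt_fieldInChart (hX : MDiffAt (T% X) p) :
    DifferentiableAt ℝ (fieldInChart X p) (extChartAt I p p) := by
  have h := hX.mdifferentiableWithinAt (s := Set.univ)
    |>.differentiableWithinAt_mpullbackWithin_vectorField
  rw [Set.preimage_univ, Set.univ_inter, I.range_eq_univ] at h
  rw [fieldInChart, I.range_eq_univ]
  exact differentiableWithinAt_univ.1 h

omit [IsManifold I ∞ M] [CompleteSpace E] in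
lemma mlieBracket_eq_lieBracket_fieldInChart [IsManifold I 1 M] :
    mlieBracket I X Y p
      = lieBracket ℝ (fieldInChart X p) (fieldInChart Y p) (extChartAt I p p) := by
  have inverse_id_apply (L : E →L[ℝ] E) (w : E) (hL : L = ContinuousLinearMap.id ℝ E) :
      L.inverse w = w := by
    rw [hL, ContinuousLinearMap.inverse_id, ContinuousLinearMap.id_apply]
  rw [← mlieBracketWithin_univ, mlieBracketWithin_apply]
  refine (inverse_id_apply _ _ mfderiv_extChartAt_self).trans ?_
  have h : lieBracketWithin ℝ (fieldInChart X p) (fieldInChart Y p)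
      ((extChartAt I p).symm ⁻¹' Set.univ ∩ Set.range I) (extChartAt I p p)
      = lieBracket ℝ (fieldInChart X p) (fieldInChart Y p) (extChartAt I p p) := by
    rw [Set.preimage_univ, Set.univ_inter, I.range_eq_univ, lieBracketWithin_univ]
  exact h

theorem mvfderiv_mlieBracket (hf : CMDiff ∞ f) (hX : MDiffAt (T% X) p) (hY : MDiffAt (T% Y) p) :
    mvfderiv I f p (mlieBracket I X Y p)
      = fieldDeriv X (fieldDeriv Y f) p - fieldDeriv Y (fieldDeriv X f) p := by
  have hfchart : ContDiffAt ℝ ∞ (f ∘ (extChartAt I p).symm) (extChartAt I p p) := by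
    simpa [I.range_eq_univ, contDiffWithinAt_univ] using! (contMDiffAt_iff.1 (hf p)).2
  rw [mvfderiv_eq_fderiv_extChartAt (hf.mdifferentiable (by simp) p),
    mlieBracket_eq_lieBracket_fieldInChart]
  refine (fderiv_apply_lieBracket hfchart ?_ (differentiableAt_fieldInChart hY)
    (differentiableAt_fieldInChart hX)).trans ?_
  · simpa using WithTop.coe_le_coe.2 (le_top : (2 : ℕ∞) ≤ ⊤)
  · rw [fderiv_fderiv_fieldInChart hY hf, fderiv_fderiv_fieldInChart hX hf]

end

end ManifoldCalculus

section MusicalIsomorphism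

open Bundle

variable {𝕜 : Type*} [NontriviallyNormedField 𝕜]
  {E : Type*} [NormedAddCommGroup E] [NormedSpace 𝕜 E]
  {H : Type*} [TopologicalSpace H] {I : ModelWithCorners 𝕜 E H}
  {M : Type*} [TopologicalSpace M] [ChartedSpace H M] {k : ℕ∞ω} {p : M}

lemma contMDiffAt_matrix_det {ι : Type*} [Fintype ι] [DecidableEq ι] {G : M → Matrix ι ι 𝕜}
    (h : ∀ i j, CMDiffAt k (fun q ↦ G q i j) p) : CMDiffAt k (fun q ↦ (G q).det) p := by
  simp only [Matrix.det_apply']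
  exact ContMDiffAt.sum fun σ _ ↦ contMDiffAt_const.mul (ContMDiffAt.prod fun i _ ↦ h _ _)

lemma contMDiffAt_of_mulVec_eq {ι : Type*} [Fintype ι] [DecidableEq ι] {G : M → Matrix ι ι 𝕜}
    {c r : M → ι → 𝕜} (hG : ∀ i j, CMDiffAt k (fun q ↦ G q i j) p)
    (hr : ∀ i, CMDiffAt k (fun q ↦ r q i) p)
    (hdet : ∀ᶠ q in nhds p, (G q).det ≠ 0) (hc : ∀ᶠ q in nhds p, (G q).mulVec (c q) = r q)
    (i : ι) : CMDiffAt k (fun q ↦ c q i) p := by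
  have cramer_rule : ∀ᶠ q in nhds p, c q i = ((G q).det)⁻¹ * ((G q).updateCol i (r q)).det := by
    filter_upwards [hdet, hc] with q hdetq hcq
    rw [← Matrix.cramer_apply, ← Matrix.det_smul_inv_mulVec_eq_cramer _ _ hdetq.isUnit, ← hcq,
      Matrix.mulVec_mulVec, Matrix.nonsing_inv_mul _ hdetq.isUnit, Matrix.one_mulVec,
      Pi.smul_apply, smul_eq_mul, inv_mul_cancel_left₀ hdetq]
  refine ContMDiffAt.congr_of_eventuallyEq ?_ cramer_rule
  refine ((contMDiffAt_matrix_det hG).inv₀ hdet.self_of_nhds).mul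
    (contMDiffAt_matrix_det fun j l ↦ ?_)
  by_cases hl : l = i
  · simpa only [hl, Matrix.updateCol_self] using hr j
  · simpa only [Matrix.updateCol_ne hl] using hG j l

theorem contMDiffAt_section_of_nondegenerate
    {F : Type*} [NormedAddCommGroup F] [NormedSpace 𝕜 F] [FiniteDimensional 𝕜 F]
    {W : M → Type*} [TopologicalSpace (TotalSpace F W)]
    [∀ q, AddCommGroup (W q)] [∀ q, Module 𝕜 (W q)] [∀ q, TopologicalSpace (W q)]
    [FiberBundle F W] [VectorBundle 𝕜 F W] [ContMDiffVectorBundle k F W I]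
    {g : Π q, LinearMap.BilinForm 𝕜 (W q)} (hg : ∀ q, (g q).Nondegenerate)
    (hg_smooth : ∀ s t : Π q, W q, CMDiffAt k (T% s) p → CMDiffAt k (T% t) p →
      CMDiffAt k (fun q ↦ g q (s q) (t q)) p)
    {u : Π q, W q} (hu : ∀ s : Π q, W q, CMDiffAt k (T% s) p →
      CMDiffAt k (fun q ↦ g q (s q) (u q)) p) :
    CMDiffAt k (T% u) p := by
  classical
  set e := trivializationAt F W p
  have hframe := e.isLocalFrameOn_localFrame_baseSet I k (Module.finBasis 𝕜 F)
  have he : e.baseSet ∈ nhds p :=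
    e.open_baseSet.mem_nhds (FiberBundle.mem_baseSet_trivializationAt' p)
  set s := e.localFrame (Module.finBasis 𝕜 F)
  have hs (i) : CMDiffAt k (T% (s i)) p := (hframe.contMDiffOn i).contMDiffAt he
  refine hframe.contMDiffAt_of_coeff (fun i ↦ ?_) he
  refine contMDiffAt_of_mulVec_eq (G := fun q ↦ Matrix.of fun i j ↦ g q (s i q) (s j q))
    (c := fun q i ↦ hframe.coeff i q (u q)) (r := fun q i ↦ g q (s i q) (u q))
    (fun i j ↦ hg_smooth _ _ (hs i) (hs j)) (fun i ↦ hu _ (hs i)) ?_ ?_ i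
  · filter_upwards [he] with q hq
    have h := (LinearMap.BilinForm.nondegenerate_iff_det_ne_zero (hframe.toBasisAt hq)).1 (hg q)
    convert h using 2
    ext i j
    simp [LinearMap.BilinForm.toMatrix_apply]
  · filter_upwards [he] with q hq
    ext i
    conv_rhs => rw [hframe.coeff_sum_eq u hq]
    simp [Matrix.mulVec, dotProduct, mul_comm]

end MusicalIsomorphism

lemma exists_contMDiff_vectorField_eq {E : Type*} [NormedAddCommGroup E] [NormedSpace ℝ E]
    [FiniteDimensional ℝ E] {H : Type*} [TopologicalSpace H] {I : ModelWithCorners ℝ E H}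
    {M : Type*} [TopologicalSpace M] [T2Space M] [ChartedSpace H M] [IsManifold I ∞ M] {p : M}
    (v : TangentSpace I p) : ∃ X : Π q : M, TangentSpace I q, CMDiff ∞ (T% X) ∧ X p = v := by
  obtain ⟨s, hs, hsv⟩ := FiberBundle.exists_contMDiffOn_extend (k := ∞) I E v
  obtain ⟨u, hus, hu, hpu⟩ := mem_nhds_iff.1 hs
  obtain ⟨f, hf, -⟩ := (SmoothBumpFunction.nhds_basis_support (I := I)
    (hu.mem_nhds hpu)).mem_iff.1 (hu.mem_nhds hpu)
  refine ⟨(f : M → ℝ) • FiberBundle.extend E v, ?_, ?_⟩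
  · exact ContMDiffOn.smul_section_of_tsupport f.contMDiff.contMDiffOn hu hf (hsv.mono hus)
  · simp

section Pseudohermitian

open VectorField

variable {m : ℕ} {M : Type*} [TopologicalSpace M] [ChartedSpace (CRModel m) M]
  [IsManifold (𝓡 (2 * m + 1)) ∞ M]

namespace IsSmoothField

variable {X Y : VField m M}

lemma mdifferentiableAt (hX : IsSmoothField X) (p : M) :
    MDifferentiableAt (𝓡 (2 * m + 1)) (𝓡 (2 * m + 1)).tangent (T% X) p :=
  ContMDiff.mdifferentiable hX (by simp) p

lemma sub (hX : IsSmoothField X) (hY : IsSmoothField Y) : IsSmoothField (X - Y) :=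
  ContMDiff.sub_section hX hY

lemma smul {f : M → ℝ} (hf : ContMDiff (𝓡 (2 * m + 1)) 𝓘(ℝ, ℝ) ∞ f) (hX : IsSmoothField X) :
    IsSmoothField (f • X) :=
  ContMDiff.smul_section hf hX

lemma mlieBracket (hX : IsSmoothField X) (hY : IsSmoothField Y) :
    IsSmoothField (mlieBracket (𝓡 (2 * m + 1)) X Y) := fun p ↦ by
  have : IsManifold (𝓡 (2 * m + 1)) (minSmoothness ℝ 2) M := by
    rw [minSmoothness_of_isRCLikeNormedField]
    infer_instance
  have : IsManifold (𝓡 (2 * m + 1)) (∞ + 1) M := ‹IsManifold (𝓡 (2 * m + 1)) ∞ M›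
  exact (hX p).mlieBracket_vectorField (n := ⊤) (m := ⊤) (hY p) (by simp)

end IsSmoothField

namespace PseudohermitianStructure

variable {S : PseudohermitianStructure m M} {X Y Z T : VField m M}

lemma IsHorizontal.sub (hX : S.IsHorizontal X) (hY : S.IsHorizontal Y) :
    S.IsHorizontal (X - Y) := fun p ↦ by
  rw [Pi.sub_apply, map_sub, hX, hY, sub_zero]

lemma IsHorizontal.neg (hX : S.IsHorizontal X) : S.IsHorizontal (-X) := fun p ↦ by
  rw [Pi.neg_apply, map_neg, hX, neg_zero]

lemma IsHorizontal.JField (hX : S.IsHorizontal X) : S.IsHorizontal (S.JField X) := fun p ↦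
  S.J_mem p _ (hX p)

lemma IsHorizontal.isSmoothField_JField (hXh : S.IsHorizontal X) (hX : IsSmoothField X) :
    IsSmoothField (S.JField X) :=
  S.smooth_J X hX hXh

lemma IsHorizontal.JField_JField (hX : S.IsHorizontal X) : S.JField (S.JField X) = -X :=
  funext fun p ↦ S.J_sq p _ (hX p)

lemma J_injOn {p : M} {v : TangentSpace (𝓡 (2 * m + 1)) p} (hv : S.θ p v = 0)
    (h : S.J p v = 0) : v = 0 := by
  rw [← neg_eq_zero, ← S.J_sq p v hv, h, map_zero]

lemma extd_of_isHorizontal (hX : S.IsHorizontal X) (hY : S.IsHorizontal Y) (p : M) :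
    extd S.θ X Y p = -S.θ p (mlieBracket (𝓡 (2 * m + 1)) X Y p) := by
  have h (Z : VField m M) (hZ : S.IsHorizontal Z) (v : TangentSpace (𝓡 (2 * m + 1)) p) :
      dirDeriv (fun q ↦ S.θ q (Z q)) p v = 0 := by
    rw [funext hZ]
    exact congrArg (fun L : CRModel m →L[ℝ] ℝ ↦ L v) (mfderiv_const (c := (0 : ℝ)))
  rw [extd, h X hX, h Y hY, sub_zero, zero_sub]

lemma extd_swap (p : M) : extd S.θ X Y p = -extd S.θ Y X p := by
  rw [extd, extd, mlieBracket_swap_apply, map_neg]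
  ring

lemma extd_sub_left (hX : IsSmoothField X) (hY : IsSmoothField Y) (hXh : S.IsHorizontal X)
    (hYh : S.IsHorizontal Y) (hZh : S.IsHorizontal Z) (p : M) :
    extd S.θ (X - Y) Z p = extd S.θ X Z p - extd S.θ Y Z p := by
  have h := mlieBracket_add_left (W := Z) ((hX.sub hY).mdifferentiableAt p)
    (hY.mdifferentiableAt p)
  rw [sub_add_cancel] at h
  rw [extd_of_isHorizontal (hXh.sub hYh) hZh, extd_of_isHorizontal hXh hZh,
    extd_of_isHorizontal hYh hZh, h, map_add]
  ring

lemma extd_neg_right (hY : IsSmoothField Y) (hXh : S.IsHorizontal X) (hYh : S.IsHorizontal Y)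
    (p : M) : extd S.θ X (-Y) p = -extd S.θ X Y p := by
  have h := mlieBracket_const_smul_right (V := X) (c := (-1 : ℝ)) (hY.mdifferentiableAt p)
  simp only [neg_one_smul] at h
  rw [extd_of_isHorizontal hXh (hYh.neg), extd_of_isHorizontal hXh hYh, h, map_neg]

lemma extd_JField_JField (hX : IsSmoothField X) (hY : IsSmoothField Y) (hXh : S.IsHorizontal X)
    (hYh : S.IsHorizontal Y) (p : M) :
    extd S.θ (S.JField X) (S.JField Y) p = extd S.θ X Y p := by
  have h := S.bracket_mem X Y hX hY hXh hYh p
  rw [map_sub, sub_eq_zero] at h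
  rw [extd_of_isHorizontal hXh hYh, extd_of_isHorizontal hXh.JField hYh.JField, h]
  rfl

lemma extd_JField_left (hX : IsSmoothField X) (hY : IsSmoothField Y) (hXh : S.IsHorizontal X)
    (hYh : S.IsHorizontal Y) (p : M) :
    extd S.θ (S.JField X) Y p = -extd S.θ X (S.JField Y) p := by
  have h := extd_JField_JField hX (hYh.isSmoothField_JField hY) hXh hYh.JField p
  rw [← h, hYh.JField_JField, extd_neg_right hY hXh.JField hYh, neg_neg]

lemma eq_zero_of_extd_JField_eq_zero (hX : IsSmoothField X) (hXh : S.IsHorizontal X) {p : M}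
    (h : extd S.θ X (S.JField X) p = 0) : X p = 0 :=
  of_not_not fun hne ↦ (S.levi_pos X hX hXh p hne).ne' h

namespace IsReebField

lemma isHorizontal_sub_smul (hT : S.IsReebField T) :
    S.IsHorizontal (X - (fun p ↦ S.θ p (X p)) • T) := fun p ↦ by
  simp [hT.θ_eq_one]

lemma exists_isHorizontal_eq [T2Space M] (hT : S.IsReebField T) {p : M}
    {v : TangentSpace (𝓡 (2 * m + 1)) p} (hv : S.θ p v = 0) :
    ∃ X : VField m M, IsSmoothField X ∧ S.IsHorizontal X ∧ X p = v := by
  obtain ⟨X, hX, rfl⟩ := exists_contMDiff_vectorField_eq v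
  refine ⟨X - (fun q ↦ S.θ q (X q)) • T, ?_, hT.isHorizontal_sub_smul, ?_⟩
  · exact .sub hX (.smul (S.smooth_θ X hX) hT.smooth)
  · simp [hv]

lemma eq_add_smul (hT : S.IsReebField T) (p : M) (v : TangentSpace (𝓡 (2 * m + 1)) p) :
    ∃ w, S.θ p w = 0 ∧ v = w + S.θ p v • T p :=
  ⟨v - S.θ p v • T p, by simp [hT.θ_eq_one], (sub_add_cancel _ _).symm⟩

end IsReebField

namespace IsPseudohermitianConnection

variable {D : AffineConnection m M}

lemma isSmoothField_curvature (hD : S.IsPseudohermitianConnection T D) (hX : IsSmoothField X)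
    (hY : IsSmoothField Y) (hZ : IsSmoothField Z) : IsSmoothField (curvature D X Y Z) :=
  .sub (.sub (hD.smooth X _ hX (hD.smooth Y Z hY hZ)) (hD.smooth Y _ hY (hD.smooth X Z hX hZ)))
    (hD.smooth _ Z (hX.mlieBracket hY) hZ)

lemma isHorizontal_apply (hD : S.IsPseudohermitianConnection T D) (hY : IsSmoothField Y)
    (hYh : S.IsHorizontal Y) : S.IsHorizontal (fun p ↦ D Y p (X p)) := fun p ↦
  hD.horizontal Y hY hYh p (X p)

end IsPseudohermitianConnection

end PseudohermitianStructure

end Pseudohermitian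

section TanakaWebsterUniqueness

open VectorField

variable {m : ℕ} {M : Type*} [TopologicalSpace M] [ChartedSpace (CRModel m) M]
  [IsManifold (𝓡 (2 * m + 1)) ∞ M]

/-- The difference `D_X Y - D'_X Y` of two connections. -/
noncomputable def connectionDiff (D D' : AffineConnection m M) (X Y : VField m M) : VField m M :=
  fun p ↦ D Y p (X p) - D' Y p (X p)

namespace PseudohermitianStructure.IsPseudohermitianConnection

variable {S : PseudohermitianStructure m M} {X Y Z T : VField m M} {D D' : AffineConnection m M}

lemma isSmoothField_connectionDiff (hD : S.IsPseudohermitianConnection T D)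
    (hD' : S.IsPseudohermitianConnection T D') (hX : IsSmoothField X) (hY : IsSmoothField Y) :
    IsSmoothField (connectionDiff D D' X Y) :=
  .sub (hD.smooth X Y hX hY) (hD'.smooth X Y hX hY)

lemma isHorizontal_connectionDiff (hD : S.IsPseudohermitianConnection T D)
    (hD' : S.IsPseudohermitianConnection T D') (hY : IsSmoothField Y) (hYh : S.IsHorizontal Y) :
    S.IsHorizontal (connectionDiff D D' X Y) :=
  .sub (hD.isHorizontal_apply hY hYh) (hD'.isHorizontal_apply hY hYh)

lemma connectionDiff_comm (hD : S.IsPseudohermitianConnection T D)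
    (hD' : S.IsPseudohermitianConnection T D') (hX : IsSmoothField X) (hY : IsSmoothField Y)
    (hXh : S.IsHorizontal X) (hYh : S.IsHorizontal Y) :
    connectionDiff D D' X Y = connectionDiff D D' Y X := funext fun p ↦ by
  have h := (hD.torsion_horizontal X Y hX hY hXh hYh p).trans
    (hD'.torsion_horizontal X Y hX hY hXh hYh p).symm
  rw [D.torsion_apply (hX.mdifferentiableAt p) (hY.mdifferentiableAt p),
    D'.torsion_apply (hX.mdifferentiableAt p) (hY.mdifferentiableAt p)] at h
  exact sub_eq_sub_iff_sub_eq_sub.1 (sub_left_injective h)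

lemma connectionDiff_JField (hD : S.IsPseudohermitianConnection T D)
    (hD' : S.IsPseudohermitianConnection T D') (hY : IsSmoothField Y) (hYh : S.IsHorizontal Y) :
    connectionDiff D D' X (S.JField Y) = S.JField (connectionDiff D D' X Y) := funext fun p ↦ by
  rw [connectionDiff, hD.J_parallel Y hY hYh, hD'.J_parallel Y hY hYh, ← map_sub]
  rfl

lemma extd_connectionDiff_comm (hD : S.IsPseudohermitianConnection T D)
    (hD' : S.IsPseudohermitianConnection T D') (hX : IsSmoothField X) (hY : IsSmoothField Y)
    (hZ : IsSmoothField Z) (hYh : S.IsHorizontal Y) (hZh : S.IsHorizontal Z) (p : M) :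
    extd S.θ (connectionDiff D D' X Y) Z p = extd S.θ (connectionDiff D D' X Z) Y p := by
  have h := (hD.metric X Y Z hX hY hZ hYh hZh p).symm.trans (hD'.metric X Y Z hX hY hZ hYh hZh p)
  rw [extd_swap (X := Y), extd_swap (X := Y)] at h
  have hsub {U W : VField m M} (hU : IsSmoothField U) (hUh : S.IsHorizontal U)
      (hWh : S.IsHorizontal W) : extd S.θ (connectionDiff D D' X U) W p
        = extd S.θ (fun q ↦ D U q (X q)) W p - extd S.θ (fun q ↦ D' U q (X q)) W p :=
    extd_sub_left (hD.smooth X U hX hU) (hD'.smooth X U hX hU) (hD.isHorizontal_apply hU hUh)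
      (hD'.isHorizontal_apply hU hUh) hWh p
  rw [hsub hY hYh hZh, hsub hZ hZh hYh]
  linarith

lemma extd_connectionDiff_JField (hD : S.IsPseudohermitianConnection T D)
    (hD' : S.IsPseudohermitianConnection T D') (hX : IsSmoothField X) (hY : IsSmoothField Y)
    (hYh : S.IsHorizontal Y) (hZ : IsSmoothField Z) (hZh : S.IsHorizontal Z) (p : M) :
    extd S.θ (connectionDiff D D' X (S.JField Y)) Z p
      = -extd S.θ (connectionDiff D D' X Y) (S.JField Z) p := by
  rw [hD.connectionDiff_JField hD' hY hYh, extd_JField_left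
    (hD.isSmoothField_connectionDiff hD' hX hY) hZ (hD.isHorizontal_connectionDiff hD' hY hYh) hZh]

-- `c(X, Y, Z) = dθ(D_X Y - D'_X Y, Z)` is totally symmetric, and moving `J` from one of its
-- arguments to another changes the sign; moving `J` around the three arguments gives `c = -c`.
lemma connectionDiff_eq_zero (hD : S.IsPseudohermitianConnection T D)
    (hD' : S.IsPseudohermitianConnection T D') (hX : IsSmoothField X) (hY : IsSmoothField Y)
    (hXh : S.IsHorizontal X) (hYh : S.IsHorizontal Y) : connectionDiff D D' X Y = 0 := by
  set A := connectionDiff D D' with hA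
  have extd_J_eq_zero {Z : VField m M} (hZ : IsSmoothField Z) (hZh : S.IsHorizontal Z) (p : M) :
      extd S.θ (A X Y) (S.JField Z) p = 0 := by
    have hJX := hXh.isSmoothField_JField hX
    have hJY := hYh.isSmoothField_JField hY
    have hYZ : extd S.θ (A X (S.JField Y)) Z p = -extd S.θ (A X Y) (S.JField Z) p :=
      hD.extd_connectionDiff_JField hD' hX hY hYh hZ hZh p
    have hXZ : extd S.θ (A (S.JField X) Y) Z p = -extd S.θ (A X Y) (S.JField Z) p := by
      rw [hA, hD.connectionDiff_comm hD' hJX hY hXh.JField hYh,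
        hD.extd_connectionDiff_JField hD' hY hX hXh hZ hZh,
        hD.connectionDiff_comm hD' hY hX hYh hXh]
    have hXY : extd S.θ (A (S.JField X) Y) Z p = -extd S.θ (A X (S.JField Y)) Z p := by
      rw [hA, hD.connectionDiff_comm hD' hJX hY hXh.JField hYh,
        hD.extd_connectionDiff_comm hD' hY hJX hZ hXh.JField hZh,
        hD.connectionDiff_comm hD' hY hZ hYh hZh,
        hD.extd_connectionDiff_comm hD' hZ hY hJX hYh hXh.JField,
        hD.extd_connectionDiff_JField hD' hZ hX hXh hY hYh,
        hD.connectionDiff_comm hD' hZ hX hZh hXh,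
        hD.extd_connectionDiff_comm hD' hX hZ hJY hZh hYh.JField]
    linarith
  have hAs : IsSmoothField (A X Y) := hD.isSmoothField_connectionDiff hD' hX hY
  have hAh : S.IsHorizontal (A X Y) := hD.isHorizontal_connectionDiff hD' hY hYh
  exact funext fun p ↦ eq_zero_of_extd_JField_eq_zero hAs hAh (extd_J_eq_zero hAs hAh p)

lemma connectionDiff_reeb_eq_zero (hD : S.IsPseudohermitianConnection T D)
    (hD' : S.IsPseudohermitianConnection T D') (hT : IsSmoothField T) (hY : IsSmoothField Y)
    (hYh : S.IsHorizontal Y) : connectionDiff D D' T Y = 0 := funext fun p ↦ by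
  have torsion_sub {W : VField m M} (hW : IsSmoothField W) :
      D.torsion p (T p) (W p) - D'.torsion p (T p) (W p) = connectionDiff D D' T W p := by
    rw [D.torsion_apply (hT.mdifferentiableAt p) (hW.mdifferentiableAt p),
      D'.torsion_apply (hT.mdifferentiableAt p) (hW.mdifferentiableAt p), hD.reeb_parallel,
      hD'.reeb_parallel, connectionDiff]
    abel
  have commutes := congrFun (hD.connectionDiff_JField hD' (X := T) hY hYh) p
  have anticommutes : connectionDiff D D' T (S.JField Y) p
      = -S.J p (connectionDiff D D' T Y p) := by
    rw [← torsion_sub (hYh.isSmoothField_JField hY), ← torsion_sub hY, JField,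
      hD.torsion_reeb p _ (hYh p), hD'.torsion_reeb p _ (hYh p), map_sub]
    abel
  have : IsAddTorsionFree (CRModel m) := .of_isTorsionFree ℝ _
  exact S.J_injOn (hD.isHorizontal_connectionDiff hD' hY hYh p)
    ((self_eq_neg (G := CRModel m)).1 (commutes.symm.trans anticommutes))

lemma apply_eq [T2Space M] (hT : S.IsReebField T) (hD : S.IsPseudohermitianConnection T D)
    (hD' : S.IsPseudohermitianConnection T D') (hY : IsSmoothField Y) (hYh : S.IsHorizontal Y)
    (p : M) (v : TangentSpace (𝓡 (2 * m + 1)) p) : D Y p v = D' Y p v := by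
  obtain ⟨w, hw, hv⟩ := hT.eq_add_smul p v
  obtain ⟨X, hX, hXh, rfl⟩ := hT.exists_isHorizontal_eq hw
  have hXY := sub_eq_zero.1 (congrFun (hD.connectionDiff_eq_zero hD' hX hY hXh hYh) p)
  have hTY := sub_eq_zero.1 (congrFun (hD.connectionDiff_reeb_eq_zero hD' hT.smooth hY hYh) p)
  rw [hv, map_add, map_add, map_smul, map_smul, hXY, hTY]

lemma torsion_reeb_eq [T2Space M] (hT : S.IsReebField T) (hD : S.IsPseudohermitianConnection T D)
    (hD' : S.IsPseudohermitianConnection T D') (p : M) (v : TangentSpace (𝓡 (2 * m + 1)) p) :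
    D.torsion p (T p) v = D'.torsion p (T p) v := by
  obtain ⟨w, hw, hv⟩ := hT.eq_add_smul p v
  obtain ⟨X, hX, hXh, rfl⟩ := hT.exists_isHorizontal_eq hw
  rw [hv, map_add, map_add, map_smul, map_smul, D.torsion_self, D'.torsion_self,
    D.torsion_apply (hT.smooth.mdifferentiableAt p) (hX.mdifferentiableAt p),
    D'.torsion_apply (hT.smooth.mdifferentiableAt p) (hX.mdifferentiableAt p),
    hD.reeb_parallel, hD'.reeb_parallel, hD.apply_eq hT hD' hX hXh]

end PseudohermitianStructure.IsPseudohermitianConnection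

end TanakaWebsterUniqueness

section VerticalImmersion

open Bundle VectorField

variable {m : ℕ} {M : Type*} [TopologicalSpace M] [ChartedSpace (CRModel m) M]
  {V : Type*} [NormedAddCommGroup V] [InnerProductSpace ℂ V] [NormedSpace ℝ V]

/-- The complex span of the image of the differential of `φ` at `p`. -/
def derivSpan (φ : M → V) (p : M) : Submodule ℂ V :=
  Submodule.span ℂ (Set.range (mvfderiv (𝓡 (2 * m + 1)) φ p))

variable {φ : M → V} {τ : M → ℝ} {p : M}

lemma mvfderiv_mem_derivSpan (v : TangentSpace (𝓡 (2 * m + 1)) p) :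
    mvfderiv (𝓡 (2 * m + 1)) φ p v ∈ derivSpan (m := m) φ p :=
  Submodule.subset_span ⟨v, rfl⟩

lemma fieldDeriv_mem_derivSpan (X : VField m M) : fieldDeriv X φ p ∈ derivSpan (m := m) φ p :=
  mvfderiv_mem_derivSpan (X p)

instance finiteDimensional_derivSpan [IsScalarTower ℝ ℂ V] :
    FiniteDimensional ℂ (derivSpan (m := m) φ p) := by
  have : FiniteDimensional ℝ (TangentSpace (𝓡 (2 * m + 1)) p) :=
    inferInstanceAs (FiniteDimensional ℝ (CRModel m))
  obtain ⟨s, hs⟩ := Submodule.FG.map (mvfderiv (𝓡 (2 * m + 1)) φ p).toLinearMap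
    (Module.Finite.fg_top (R := ℝ))
  refine Module.Finite.iff_fg.2 ⟨s, ?_⟩
  rw [derivSpan, ← Submodule.span_span_of_tower ℝ ℂ, hs, Submodule.map_top]
  rfl

variable [IsManifold (𝓡 (2 * m + 1)) ∞ M]

/-- The map `(φ, τ)` from `M` to the Heisenberg group `V × ℝ`, with contact form `dt + Im ⟪z, dz⟫`,
is a vertical pseudohermitian immersion: it pulls the contact form back to `θ`, it is holomorphic
and immersive along the contact bundle, and `∂/∂t` is tangent to its image. -/
structure PseudohermitianStructure.IsVerticalImmersion (S : PseudohermitianStructure m M)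
    (φ : M → V) (τ : M → ℝ) : Prop where
  smooth_fst : ContMDiff (𝓡 (2 * m + 1)) 𝓘(ℝ, V) ∞ φ
  smooth_snd : ContMDiff (𝓡 (2 * m + 1)) 𝓘(ℝ, ℝ) ∞ τ
  θ_eq : ∀ p v, S.θ p v = mvfderiv (𝓡 (2 * m + 1)) τ p v
    + (⟪φ p, mvfderiv (𝓡 (2 * m + 1)) φ p v⟫_ℂ).im
  complex : ∀ p v, S.θ p v = 0 →
    mvfderiv (𝓡 (2 * m + 1)) φ p (S.J p v) = Complex.I • mvfderiv (𝓡 (2 * m + 1)) φ p v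
  immersive : ∀ p v, S.θ p v = 0 → mvfderiv (𝓡 (2 * m + 1)) φ p v = 0 → v = 0
  exists_transverse : ∀ p, ∃ v, S.θ p v = 1 ∧ mvfderiv (𝓡 (2 * m + 1)) φ p v = 0

namespace PseudohermitianStructure.IsVerticalImmersion

variable {S : PseudohermitianStructure m M} {X Y Z T : VField m M}

lemma ext (h : S.IsVerticalImmersion φ τ) {u v : TangentSpace (𝓡 (2 * m + 1)) p}
    (hθ : S.θ p u = S.θ p v)
    (hφ : mvfderiv (𝓡 (2 * m + 1)) φ p u = mvfderiv (𝓡 (2 * m + 1)) φ p v) : u = v := by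
  rw [← sub_eq_zero]
  exact h.immersive p _ (by rw [map_sub, hθ, sub_self]) (by rw [map_sub, hφ, sub_self])

lemma contMDiffAt_θ (h : S.IsVerticalImmersion φ τ)
    (hX : ContMDiffAt (𝓡 (2 * m + 1)) (𝓡 (2 * m + 1)).tangent ∞ (T% X) p) :
    ContMDiffAt (𝓡 (2 * m + 1)) 𝓘(ℝ, ℝ) ∞ (fun q ↦ S.θ q (X q)) p := by
  simp only [h.θ_eq]
  exact (contMDiffAt_fieldDeriv hX h.smooth_snd).add (Complex.imCLM.contMDiff.contMDiffAt.comp p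
    (contMDiffAt_complex_inner h.smooth_fst.contMDiffAt (contMDiffAt_fieldDeriv hX h.smooth_fst)))

lemma mdifferentiableAt_inner (h : S.IsVerticalImmersion φ τ)
    (hX : MDifferentiableAt (𝓡 (2 * m + 1)) (𝓡 (2 * m + 1)).tangent (T% X) p) :
    MDifferentiableAt (𝓡 (2 * m + 1)) 𝓘(ℝ, ℂ) (fun q ↦ ⟪φ q, fieldDeriv X φ q⟫_ℂ) p :=
  mdifferentiableAt_complex_inner (h.smooth_fst.mdifferentiable (by simp) p)
    (mdifferentiableAt_fieldDeriv hX h.smooth_fst)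

lemma mdifferentiableAt_θ (h : S.IsVerticalImmersion φ τ)
    (hX : MDifferentiableAt (𝓡 (2 * m + 1)) (𝓡 (2 * m + 1)).tangent (T% X) p) :
    MDifferentiableAt (𝓡 (2 * m + 1)) 𝓘(ℝ, ℝ) (fun q ↦ S.θ q (X q)) p := by
  simp only [h.θ_eq]
  exact (mdifferentiableAt_fieldDeriv hX h.smooth_snd).add
    (Complex.imCLM.mdifferentiableAt.comp p (h.mdifferentiableAt_inner hX))

lemma extd_eq (h : S.IsVerticalImmersion φ τ) (hX : IsSmoothField X) (hY : IsSmoothField Y)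
    (p : M) : extd S.θ X Y p = 2 * (⟪fieldDeriv X φ p, fieldDeriv Y φ p⟫_ℂ).im := by
  have deriv_θ {Z : VField m M} (hZ : IsSmoothField Z) (v : TangentSpace (𝓡 (2 * m + 1)) p) :
      dirDeriv (fun q ↦ S.θ q (Z q)) p v = mvfderiv (𝓡 (2 * m + 1)) (fieldDeriv Z τ) p v
        + (⟪mvfderiv (𝓡 (2 * m + 1)) φ p v, fieldDeriv Z φ p⟫_ℂ
          + ⟪φ p, mvfderiv (𝓡 (2 * m + 1)) (fieldDeriv Z φ) p v⟫_ℂ).im := by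
    have hZp := hZ.mdifferentiableAt p
    have hinner := h.mdifferentiableAt_inner hZp
    rw [← mvfderiv_complex_inner_apply (h.smooth_fst.mdifferentiable (by simp) p)
      (mdifferentiableAt_fieldDeriv hZp h.smooth_fst) v]
    have him := mvfderiv_comp_apply_of_hasFDerivAt Complex.imCLM.hasFDerivAt hinner v
    refine Eq.trans ?_ (congrArg _ him)
    simp only [h.θ_eq]
    exact congrArg (fun L : CRModel m →L[ℝ] ℝ ↦ L v)
      (mvfderiv_add (mdifferentiableAt_fieldDeriv hZp h.smooth_snd)
        (Complex.imCLM.mdifferentiableAt.comp p hinner))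
  have hXp := hX.mdifferentiableAt p
  have hYp := hY.mdifferentiableAt p
  rw [extd, deriv_θ hX, deriv_θ hY, h.θ_eq, mvfderiv_mlieBracket h.smooth_fst hXp hYp,
    mvfderiv_mlieBracket h.smooth_snd hXp hYp, inner_sub_right]
  have him : (⟪fieldDeriv Y φ p, fieldDeriv X φ p⟫_ℂ).im
      = -(⟪fieldDeriv X φ p, fieldDeriv Y φ p⟫_ℂ).im :=
    inner_im_symm (𝕜 := ℂ) _ _
  simp only [Complex.add_im, Complex.sub_im, fieldDeriv] at him ⊢
  linarith

lemma fieldDeriv_JField (h : S.IsVerticalImmersion φ τ) (hY : S.IsHorizontal Y) :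
    fieldDeriv (S.JField Y) φ = fun q ↦ Complex.I • fieldDeriv Y φ q :=
  funext fun q ↦ h.complex q (Y q) (hY q)

lemma levi_eq_inner (h : S.IsVerticalImmersion φ τ) (hX : IsSmoothField X) (hY : IsSmoothField Y)
    (hYh : S.IsHorizontal Y) (p : M) :
    S.levi X Y p = ⟪fieldDeriv Y φ p, fieldDeriv X φ p⟫_ℂ := by
  rw [levi, h.extd_eq hX hY, h.extd_eq hX (hYh.isSmoothField_JField hY),
    h.fieldDeriv_JField hYh, inner_smul_right, ← inner_conj_symm (fieldDeriv Y φ p)]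
  generalize ⟪fieldDeriv X φ p, fieldDeriv Y φ p⟫_ℂ = z
  rw [Complex.I_mul_im, Complex.ofReal_mul, Complex.ofReal_mul, Complex.re_eq_add_conj,
    Complex.im_eq_sub_conj]
  field_simp
  push_cast
  ring

lemma exists_eq [IsScalarTower ℝ ℂ V] (h : S.IsVerticalImmersion φ τ) {w : V}
    (hw : w ∈ derivSpan (m := m) φ p) (c : ℝ) :
    ∃ v, S.θ p v = c ∧ mvfderiv (𝓡 (2 * m + 1)) φ p v = w := by
  obtain ⟨t, hθt, hφt⟩ := h.exists_transverse p
  have adjust (v : TangentSpace (𝓡 (2 * m + 1)) p) (c : ℝ) : S.θ p (v + (c - S.θ p v) • t) = c ∧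
      mvfderiv (𝓡 (2 * m + 1)) φ p (v + (c - S.θ p v) • t)
        = mvfderiv (𝓡 (2 * m + 1)) φ p v := by
    simp [hθt, hφt]
  suffices ∃ v, mvfderiv (𝓡 (2 * m + 1)) φ p v = w by
    obtain ⟨v, rfl⟩ := this
    exact ⟨_, adjust v c⟩
  induction hw using Submodule.span_induction with
  | mem _ hw => exact hw
  | zero => exact ⟨0, map_zero _⟩
  | add _ _ _ _ hx hy =>
    obtain ⟨⟨u, rfl⟩, v, rfl⟩ := hx, hy
    exact ⟨u + v, map_add _ _ _⟩
  | smul a _ _ hx =>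
    obtain ⟨u, rfl⟩ := hx
    obtain ⟨hv, hφv⟩ := adjust u 0
    set v := u + (0 - S.θ p u) • t
    refine ⟨a.re • v + a.im • S.J p v, ?_⟩
    rw [map_add, map_smul, map_smul, h.complex p v hv, hφv, ← algebraMap_smul ℂ a.re,
      ← algebraMap_smul ℂ a.im, smul_smul, ← add_smul]
    exact congrArg (· • _) (Complex.re_add_im a)

end PseudohermitianStructure.IsVerticalImmersion

end VerticalImmersion

section ProjectedConnection

open Bundle VectorField

variable {m : ℕ} {M : Type*} [TopologicalSpace M] [ChartedSpace (CRModel m) M]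
  [IsManifold (𝓡 (2 * m + 1)) ∞ M] {V : Type*} [NormedAddCommGroup V] [InnerProductSpace ℂ V]
  [NormedSpace ℝ V] [IsScalarTower ℝ ℂ V] {S : PseudohermitianStructure m M}
  {φ : M → V} {τ : M → ℝ} {p : M} {X Y Z T : VField m M}

namespace PseudohermitianStructure

variable (S) in
/-- The adapted Riemannian metric `Re ⟪dφ, dφ⟫ + θ²`. -/
noncomputable def adaptedMetric (φ : M → V) (p : M) :
    LinearMap.BilinForm ℝ (TangentSpace (𝓡 (2 * m + 1)) p) :=
  LinearMap.mk₂ ℝ (fun v w ↦ (⟪mvfderiv (𝓡 (2 * m + 1)) φ p v,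
      mvfderiv (𝓡 (2 * m + 1)) φ p w⟫_ℂ).re + S.θ p v * S.θ p w)
    (fun _ _ _ ↦ by simp only [map_add, inner_add_left, Complex.add_re]; ring)
    (fun _ _ _ ↦ by simp [← algebraMap_smul ℂ (_ : ℝ) (_ : V), mul_add, mul_assoc])
    (fun _ _ _ ↦ by simp only [map_add, inner_add_right, Complex.add_re]; ring)
    (fun _ _ _ ↦ by simp [← algebraMap_smul ℂ (_ : ℝ) (_ : V), mul_add, mul_left_comm])

namespace IsVerticalImmersion

lemma nondegenerate_adaptedMetric (h : S.IsVerticalImmersion φ τ) (p : M) :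
    (S.adaptedMetric φ p).Nondegenerate := by
  have hsymm : (S.adaptedMetric φ p).IsSymm := ⟨fun v w ↦ by
    simp only [adaptedMetric, LinearMap.mk₂_apply, mul_comm (S.θ p v)]
    exact congrArg (· + _) (inner_re_symm (𝕜 := ℂ) _ _)⟩
  refine (LinearMap.IsRefl.nondegenerate_iff_separatingLeft hsymm.isRefl).2 fun v hv ↦ ?_
  have hvv := hv v
  have hnonneg : 0 ≤ (⟪mvfderiv (𝓡 (2 * m + 1)) φ p v, mvfderiv (𝓡 (2 * m + 1)) φ p v⟫_ℂ).re :=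
    inner_self_nonneg (𝕜 := ℂ)
  simp only [adaptedMetric, LinearMap.mk₂_apply] at hvv
  have hθ : S.θ p v = 0 := by nlinarith
  rw [hθ, mul_zero, add_zero] at hvv
  exact h.immersive p v hθ ((re_inner_self_nonpos (𝕜 := ℂ)).1 hvv.le)

lemma isSmoothField_of_starProjection (h : S.IsVerticalImmersion φ τ) {w : M → V} {c : M → ℝ}
    (hw : ContMDiff (𝓡 (2 * m + 1)) 𝓘(ℝ, V) ∞ w) (hc : ContMDiff (𝓡 (2 * m + 1)) 𝓘(ℝ, ℝ) ∞ c)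
    (hφ : ∀ p, fieldDeriv X φ p = (derivSpan (m := m) φ p).starProjection (w p))
    (hθ : ∀ p, S.θ p (X p) = c p) : IsSmoothField X := fun p ↦ by
  refine contMDiffAt_section_of_nondegenerate h.nondegenerate_adaptedMetric
    (fun Y Z hY hZ ↦ ?_) (fun Y hY ↦ ?_)
  · exact (Complex.reCLM.contMDiff.contMDiffAt.comp p (contMDiffAt_complex_inner
      (contMDiffAt_fieldDeriv hY h.smooth_fst) (contMDiffAt_fieldDeriv hZ h.smooth_fst))).add
      ((h.contMDiffAt_θ hY).mul (h.contMDiffAt_θ hZ))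
  · have hYX (q : M) : S.adaptedMetric φ q (Y q) (X q)
        = (⟪fieldDeriv Y φ q, w q⟫_ℂ).re + S.θ q (Y q) * c q := by
      rw [← Submodule.starProjection_eq_self_iff.2 (fieldDeriv_mem_derivSpan (p := q) (φ := φ) Y),
        Submodule.inner_starProjection_left_eq_right, ← hφ, ← hθ]
      rfl
    simp only [hYX]
    exact (Complex.reCLM.contMDiff.contMDiffAt.comp p (contMDiffAt_complex_inner
      (contMDiffAt_fieldDeriv hY h.smooth_fst) (hw p))).add ((h.contMDiffAt_θ hY).mul (hc p))

lemma isReebField (h : S.IsVerticalImmersion φ τ) (hθ : ∀ p, S.θ p (T p) = 1)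
    (hφ : ∀ p, fieldDeriv T φ p = 0) : S.IsReebField T := by
  have hT : IsSmoothField T := h.isSmoothField_of_starProjection (w := 0) (c := 1)
    contMDiff_const contMDiff_const (fun p ↦ by rw [hφ, Pi.zero_apply, map_zero]) hθ
  refine ⟨hT, hθ, fun X hX p ↦ ?_⟩
  rw [h.extd_eq hT hX, hφ, inner_zero_left, Complex.zero_im, mul_zero]

lemma exists_isReebField (h : S.IsVerticalImmersion φ τ) :
    ∃ T : VField m M, S.IsReebField T := by
  choose T hθ hφ using h.exists_transverse
  exact ⟨T, h.isReebField hθ hφ⟩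

lemma fieldDeriv_reeb [T2Space M] (h : S.IsVerticalImmersion φ τ) (hT : S.IsReebField T) (p : M) :
    fieldDeriv T φ p = 0 := by
  obtain ⟨v, -, hv⟩ := h.exists_eq
    (Submodule.smul_mem _ Complex.I (fieldDeriv_mem_derivSpan (φ := φ) (p := p) T)) 0
  obtain ⟨X, hX, rfl⟩ := exists_contMDiff_vectorField_eq v
  have hTX := hT.extd_eq_zero X hX p
  rw [h.extd_eq hT.smooth hX, show fieldDeriv X φ p = _ from hv, inner_smul_right] at hTX
  refine (re_inner_self_nonpos (𝕜 := ℂ)).1 (le_of_eq ?_)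
  simpa using hTX

/-- The coordinates `(dφ, θ)` on the tangent space at `p`. -/
noncomputable def adaptedCoords (h : S.IsVerticalImmersion φ τ) (p : M) :
    TangentSpace (𝓡 (2 * m + 1)) p ≃ₗ[ℝ] derivSpan (m := m) φ p × ℝ :=
  LinearEquiv.ofBijective
    { toFun v := (⟨mvfderiv (𝓡 (2 * m + 1)) φ p v, mvfderiv_mem_derivSpan v⟩, S.θ p v)
      map_add' _ _ := by simp
      map_smul' _ _ := by simp }
    ⟨fun u v huv ↦ h.ext (congrArg Prod.snd huv) (congrArg (fun x ↦ (x.1 : V)) huv),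
      fun ⟨⟨_, hw⟩, c⟩ ↦ (h.exists_eq hw c).imp fun _ hv ↦ Prod.ext (Subtype.ext hv.2) hv.1⟩

/-- The endomorphism `v ↦ ∇_v Y` for the connection `connection` below. -/
noncomputable def projectedDeriv (h : S.IsVerticalImmersion φ τ) (Y : VField m M) (p : M) :
    TangentSpace (𝓡 (2 * m + 1)) p →L[ℝ] TangentSpace (𝓡 (2 * m + 1)) p :=
  have : FiniteDimensional ℝ (TangentSpace (𝓡 (2 * m + 1)) p) :=
    inferInstanceAs (FiniteDimensional ℝ (CRModel m))
  have : T2Space (TangentSpace (𝓡 (2 * m + 1)) p) := inferInstanceAs (T2Space (CRModel m))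
  LinearMap.toContinuousLinearMap ((h.adaptedCoords p).symm ∘ₗ
    ((derivSpan (m := m) φ p).orthogonalProjectionOnto.toLinearMap.restrictScalars ℝ ∘ₗ
        (mvfderiv (𝓡 (2 * m + 1)) (fieldDeriv Y φ) p).toLinearMap).prod
      (mvfderiv (𝓡 (2 * m + 1)) (fun q ↦ S.θ q (Y q)) p).toLinearMap)

lemma mvfderiv_projectedDeriv (h : S.IsVerticalImmersion φ τ) (Y : VField m M) (p : M)
    (v : TangentSpace (𝓡 (2 * m + 1)) p) :
    mvfderiv (𝓡 (2 * m + 1)) φ p (h.projectedDeriv Y p v)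
      = (derivSpan (m := m) φ p).starProjection
          (mvfderiv (𝓡 (2 * m + 1)) (fieldDeriv Y φ) p v) :=
  congrArg (fun x ↦ (x.1 : V)) ((h.adaptedCoords p).apply_symm_apply _)

lemma θ_projectedDeriv (h : S.IsVerticalImmersion φ τ) (Y : VField m M) (p : M)
    (v : TangentSpace (𝓡 (2 * m + 1)) p) :
    S.θ p (h.projectedDeriv Y p v) = mvfderiv (𝓡 (2 * m + 1)) (fun q ↦ S.θ q (Y q)) p v :=
  congrArg Prod.snd ((h.adaptedCoords p).apply_symm_apply _)

lemma projectedDeriv_add (h : S.IsVerticalImmersion φ τ)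
    (hY : MDifferentiableAt (𝓡 (2 * m + 1)) (𝓡 (2 * m + 1)).tangent (T% Y) p)
    (hZ : MDifferentiableAt (𝓡 (2 * m + 1)) (𝓡 (2 * m + 1)).tangent (T% Z) p) :
    h.projectedDeriv (Y + Z) p = h.projectedDeriv Y p + h.projectedDeriv Z p := by
  refine ContinuousLinearMap.ext fun v ↦ h.ext ?_ ?_
  · rw [add_apply, map_add]
    simp only [θ_projectedDeriv, Pi.add_apply, map_add]
    exact congrArg (fun L : CRModel m →L[ℝ] ℝ ↦ L v)
      (mvfderiv_fun_add (h.mdifferentiableAt_θ hY) (h.mdifferentiableAt_θ hZ))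
  · have hφ : fieldDeriv (Y + Z) φ = fieldDeriv Y φ + fieldDeriv Z φ :=
      funext fun q ↦ map_add _ _ _
    rw [add_apply, map_add, mvfderiv_projectedDeriv, hφ,
      mvfderiv_add (mdifferentiableAt_fieldDeriv hY h.smooth_fst)
        (mdifferentiableAt_fieldDeriv hZ h.smooth_fst), add_apply, map_add]
    simp only [mvfderiv_projectedDeriv]

lemma projectedDeriv_smul_apply (h : S.IsVerticalImmersion φ τ) {g : M → ℝ}
    (hg : MDifferentiableAt (𝓡 (2 * m + 1)) 𝓘(ℝ, ℝ) g p)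
    (hY : MDifferentiableAt (𝓡 (2 * m + 1)) (𝓡 (2 * m + 1)).tangent (T% Y) p)
    (v : TangentSpace (𝓡 (2 * m + 1)) p) :
    h.projectedDeriv (g • Y) p v
      = g p • h.projectedDeriv Y p v + mvfderiv (𝓡 (2 * m + 1)) g p v • Y p := by
  refine h.ext ?_ ?_
  · have hθ : (fun q ↦ S.θ q ((g • Y) q)) = g • fun q ↦ S.θ q (Y q) :=
      funext fun q ↦ (S.θ q).map_smul (g q) (Y q)
    rw [θ_projectedDeriv, hθ, mvfderiv_smul hg (h.mdifferentiableAt_θ hY)]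
    simp [θ_projectedDeriv]
  · have hφ : fieldDeriv (g • Y) φ = g • fieldDeriv Y φ :=
      funext fun q ↦ (mvfderiv (𝓡 (2 * m + 1)) φ q).map_smul (g q) (Y q)
    have hproj : (derivSpan (m := m) φ p).starProjection (fieldDeriv Y φ p)
        = fieldDeriv Y φ p :=
      Submodule.starProjection_eq_self_iff.2 (fieldDeriv_mem_derivSpan Y)
    rw [mvfderiv_projectedDeriv, hφ,
      mvfderiv_smul hg (mdifferentiableAt_fieldDeriv hY h.smooth_fst)]
    simp only [add_apply, smul_apply, ← algebraMap_smul ℂ (_ : ℝ) (_ : V), Complex.coe_algebraMap,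
      Complex.coe_smul, ContinuousLinearMap.smulRight_apply, map_add,
      ContinuousLinearMap.map_smul_of_tower, hproj, map_smul, mvfderiv_projectedDeriv,
      add_right_inj]
    rfl

/-- The connection with `dφ(∇_v Y)` the orthogonal projection of `v(dφ(Y))` to `derivSpan φ` and
`θ(∇_v Y) = v(θ(Y))`. -/
noncomputable def connection (h : S.IsVerticalImmersion φ τ) : AffineConnection m M where
  toFun := h.projectedDeriv
  isCovariantDerivativeOnUniv :=
    { add hY hZ _ := h.projectedDeriv_add hY hZ
      leibniz hY hg _ := ContinuousLinearMap.ext fun v ↦ h.projectedDeriv_smul_apply hg hY v }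

lemma θ_connection (h : S.IsVerticalImmersion φ τ) (Y : VField m M) (p : M)
    (v : TangentSpace (𝓡 (2 * m + 1)) p) :
    S.θ p (h.connection Y p v) = mvfderiv (𝓡 (2 * m + 1)) (fun q ↦ S.θ q (Y q)) p v :=
  h.θ_projectedDeriv Y p v

lemma mvfderiv_connection (h : S.IsVerticalImmersion φ τ) (Y : VField m M) (p : M)
    (v : TangentSpace (𝓡 (2 * m + 1)) p) :
    mvfderiv (𝓡 (2 * m + 1)) φ p (h.connection Y p v)
      = (derivSpan (m := m) φ p).starProjection
          (mvfderiv (𝓡 (2 * m + 1)) (fieldDeriv Y φ) p v) :=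
  h.mvfderiv_projectedDeriv Y p v

lemma θ_connection_of_isHorizontal (h : S.IsVerticalImmersion φ τ) (hY : S.IsHorizontal Y) (p : M)
    (v : TangentSpace (𝓡 (2 * m + 1)) p) : S.θ p (h.connection Y p v) = 0 := by
  rw [θ_connection, funext hY, mvfderiv_const, zero_apply]

lemma mvfderiv_fieldDeriv_JField (h : S.IsVerticalImmersion φ τ) (hY : IsSmoothField Y)
    (hYh : S.IsHorizontal Y) (p : M) (v : TangentSpace (𝓡 (2 * m + 1)) p) :
    mvfderiv (𝓡 (2 * m + 1)) (fieldDeriv (S.JField Y) φ) p v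
      = Complex.I • mvfderiv (𝓡 (2 * m + 1)) (fieldDeriv Y φ) p v := by
  rw [h.fieldDeriv_JField hYh]
  exact mvfderiv_comp_apply_of_hasFDerivAt
    (Complex.I • ContinuousLinearMap.id ℝ V).hasFDerivAt
    (mdifferentiableAt_fieldDeriv (hY.mdifferentiableAt p) h.smooth_fst) v

lemma isSmoothField_connection (h : S.IsVerticalImmersion φ τ) (hX : IsSmoothField X)
    (hY : IsSmoothField Y) : IsSmoothField (fun p ↦ h.connection Y p (X p)) :=
  h.isSmoothField_of_starProjection
    (fun p ↦ contMDiffAt_fieldDeriv (hX p) fun q ↦ contMDiffAt_fieldDeriv (hY q) h.smooth_fst)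
    (fun p ↦ contMDiffAt_fieldDeriv (hX p) (S.smooth_θ Y hY))
    (fun p ↦ h.mvfderiv_connection Y p (X p)) (fun p ↦ h.θ_connection Y p (X p))

lemma torsion_connection [T2Space M] (h : S.IsVerticalImmersion φ τ) (hT : S.IsReebField T)
    (hX : IsSmoothField X) (hY : IsSmoothField Y) (p : M) :
    h.connection.torsion p (X p) (Y p) = extd S.θ X Y p • T p := by
  have hXp := hX.mdifferentiableAt p
  have hYp := hY.mdifferentiableAt p
  rw [h.connection.torsion_apply hXp hYp]
  refine h.ext ?_ ?_
  · rw [map_sub, map_sub, map_smul, hT.θ_eq_one, θ_connection, θ_connection, smul_eq_mul, mul_one]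
    rfl
  · have hbracket := Submodule.starProjection_eq_self_iff.2
      (mvfderiv_mem_derivSpan (φ := φ) (mlieBracket (𝓡 (2 * m + 1)) X Y p))
    rw [map_sub, map_sub, map_smul, mvfderiv_connection, mvfderiv_connection, ← map_sub,
      show mvfderiv (𝓡 (2 * m + 1)) φ p (T p) = 0 from h.fieldDeriv_reeb hT p, smul_zero,
      sub_eq_zero, ← hbracket, mvfderiv_mlieBracket h.smooth_fst hXp hYp]
    rfl

lemma torsion_reeb_connection [T2Space M] (h : S.IsVerticalImmersion φ τ) (hT : S.IsReebField T)
    (p : M) (v : TangentSpace (𝓡 (2 * m + 1)) p) : h.connection.torsion p (T p) v = 0 := by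
  obtain ⟨X, hX, rfl⟩ := exists_contMDiff_vectorField_eq v
  rw [h.torsion_connection hT hT.smooth hX, hT.extd_eq_zero X hX, zero_smul]

lemma extd_connection (h : S.IsVerticalImmersion φ τ) (hX : IsSmoothField X)
    (hY : IsSmoothField Y) (hZ : IsSmoothField Z) (p : M) :
    dirDeriv (fun q ↦ extd S.θ Y Z q) p (X p)
      = extd S.θ (fun q ↦ h.connection Y q (X q)) Z p
        + extd S.θ Y (fun q ↦ h.connection Z q (X q)) p := by
  have hYp := mdifferentiableAt_fieldDeriv (hY.mdifferentiableAt p) h.smooth_fst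
  have hZp := mdifferentiableAt_fieldDeriv (hZ.mdifferentiableAt p) h.smooth_fst
  have fieldDeriv_connection (W : VField m M) :
      fieldDeriv (fun q ↦ h.connection W q (X q)) φ p
        = (derivSpan (m := m) φ p).starProjection (fieldDeriv X (fieldDeriv W φ) p) :=
    h.mvfderiv_connection W p (X p)
  rw [h.extd_eq (h.isSmoothField_connection hX hY) hZ,
    h.extd_eq hY (h.isSmoothField_connection hX hZ), fieldDeriv_connection, fieldDeriv_connection,
    ← Submodule.inner_starProjection_left_eq_right, Submodule.inner_starProjection_left_eq_right,
    Submodule.starProjection_eq_self_iff.2 (fieldDeriv_mem_derivSpan Y),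
    Submodule.starProjection_eq_self_iff.2 (fieldDeriv_mem_derivSpan Z), ← mul_add,
    ← Complex.add_im]
  simp only [h.extd_eq hY hZ]
  refine (mvfderiv_comp_apply_of_hasFDerivAt ((2 : ℝ) • Complex.imCLM).hasFDerivAt
    (mdifferentiableAt_complex_inner hYp hZp) (X p)).trans ?_
  rw [mvfderiv_complex_inner_apply hYp hZp]
  rfl

lemma isPseudohermitianConnection_connection [T2Space M] (h : S.IsVerticalImmersion φ τ)
    (hT : S.IsReebField T) : S.IsPseudohermitianConnection T h.connection where
  smooth _ _ hX hY := h.isSmoothField_connection hX hY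
  horizontal _ _ hY p v := h.θ_connection_of_isHorizontal hY p v
  reeb_parallel p v := by
    refine h.ext ?_ ?_
    · rw [θ_connection, funext hT.θ_eq_one, mvfderiv_const, map_zero, zero_apply]
    · rw [mvfderiv_connection, funext (h.fieldDeriv_reeb hT), mvfderiv_const, map_zero, zero_apply,
        map_zero]
  J_parallel Y hY hYh p v := by
    have hconn := h.θ_connection_of_isHorizontal hYh p v
    refine h.ext ?_ ?_
    · rw [S.J_mem p _ hconn, h.θ_connection_of_isHorizontal hYh.JField]
    · rw [mvfderiv_connection, h.mvfderiv_fieldDeriv_JField hY hYh, map_smul, h.complex p _ hconn,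
        mvfderiv_connection]
  metric _ _ _ hX hY hZ _ _ p := h.extd_connection hX hY hZ p
  torsion_horizontal _ _ hX hY _ _ p := h.torsion_connection hT hX hY p
  torsion_reeb p v _ := by simp only [h.torsion_reeb_connection hT, map_zero, neg_zero]

end IsVerticalImmersion

namespace IsPseudohermitianConnection

variable {D : AffineConnection m M}

lemma mvfderiv_apply [T2Space M] (hD : S.IsPseudohermitianConnection T D)
    (hT : S.IsReebField T) (h : S.IsVerticalImmersion φ τ) (hY : IsSmoothField Y)
    (hYh : S.IsHorizontal Y) (p : M) (v : TangentSpace (𝓡 (2 * m + 1)) p) :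
    mvfderiv (𝓡 (2 * m + 1)) φ p (D Y p v) = (derivSpan (m := m) φ p).starProjection
      (mvfderiv (𝓡 (2 * m + 1)) (fieldDeriv Y φ) p v) := by
  rw [hD.apply_eq hT (h.isPseudohermitianConnection_connection hT) hY hYh, h.mvfderiv_connection]

lemma torsion_reeb_eq_zero [T2Space M] (hD : S.IsPseudohermitianConnection T D)
    (hT : S.IsReebField T) (h : S.IsVerticalImmersion φ τ) (p : M)
    (v : TangentSpace (𝓡 (2 * m + 1)) p) : D.torsion p (T p) v = 0 := by
  rw [torsion_reeb_eq hT hD (h.isPseudohermitianConnection_connection hT),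
    h.torsion_reeb_connection hT]

end IsPseudohermitianConnection

end PseudohermitianStructure

end ProjectedConnection

section GaussEquation

variable {m : ℕ} {M : Type*} [TopologicalSpace M] [ChartedSpace (CRModel m) M]
  {V : Type*} [NormedAddCommGroup V] [InnerProductSpace ℂ V] [NormedSpace ℝ V]
  [IsScalarTower ℝ ℂ V]

/-- The second fundamental form `II(X, Y)` of `φ` as a normal vector: the component of the second
derivative `XYφ` orthogonal to `derivSpan φ`. -/
noncomputable def normalDeriv (φ : M → V) (X Y : VField m M) (p : M) : V :=
  (derivSpan (m := m) φ p)ᗮ.starProjection (fieldDeriv X (fieldDeriv Y φ) p)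

variable {φ : M → V} {τ : M → ℝ} {p : M} {X Y Z W T : VField m M}

lemma inner_normalDeriv_of_mem {w : V} (hw : w ∈ derivSpan (m := m) φ p) :
    ⟪w, normalDeriv φ X Y p⟫_ℂ = 0 :=
  Submodule.inner_right_of_mem_orthogonal hw (Submodule.starProjection_apply_mem _ _)

variable [IsManifold (𝓡 (2 * m + 1)) ∞ M] {S : PseudohermitianStructure m M}

namespace PseudohermitianStructure.IsVerticalImmersion

lemma normalDeriv_eq (h : S.IsVerticalImmersion φ τ) (X Y : VField m M) (p : M) :
    normalDeriv φ X Y p = fieldDeriv X (fieldDeriv Y φ) p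
      - fieldDeriv (fun q ↦ h.connection Y q (X q)) φ p := by
  rw [normalDeriv, Submodule.starProjection_orthogonal_val]
  exact congrArg (_ - ·) (h.mvfderiv_connection Y p (X p)).symm

lemma mdifferentiableAt_normalDeriv (h : S.IsVerticalImmersion φ τ) (hX : IsSmoothField X)
    (hY : IsSmoothField Y) (p : M) :
    MDifferentiableAt (𝓡 (2 * m + 1)) 𝓘(ℝ, V) (normalDeriv φ X Y) p := by
  rw [funext (h.normalDeriv_eq X Y)]
  exact (mdifferentiableAt_fieldDeriv (hX.mdifferentiableAt p)
      fun q ↦ contMDiffAt_fieldDeriv (hY q) h.smooth_fst).sub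
    (mdifferentiableAt_fieldDeriv ((h.isSmoothField_connection hX hY).mdifferentiableAt p)
      h.smooth_fst)

lemma normalDeriv_comm (h : S.IsVerticalImmersion φ τ) (hX : IsSmoothField X)
    (hY : IsSmoothField Y) (p : M) : normalDeriv φ X Y p = normalDeriv φ Y X p := by
  rw [← sub_eq_zero, normalDeriv, normalDeriv, ← map_sub]
  refine Submodule.starProjection_orthogonal_apply_eq_zero ?_
  exact mvfderiv_mlieBracket h.smooth_fst (hX.mdifferentiableAt p) (hY.mdifferentiableAt p) ▸
    mvfderiv_mem_derivSpan _

lemma normalDeriv_JField_right (h : S.IsVerticalImmersion φ τ) (hY : IsSmoothField Y)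
    (hYh : S.IsHorizontal Y) (X : VField m M) (p : M) :
    normalDeriv φ X (S.JField Y) p = Complex.I • normalDeriv φ X Y p := by
  rw [normalDeriv, fieldDeriv, h.mvfderiv_fieldDeriv_JField hY hYh, map_smul]
  rfl

lemma normalDeriv_JField_left (h : S.IsVerticalImmersion φ τ) (hX : IsSmoothField X)
    (hXh : S.IsHorizontal X) (hY : IsSmoothField Y) (p : M) :
    normalDeriv φ (S.JField X) Y p = Complex.I • normalDeriv φ X Y p := by
  rw [h.normalDeriv_comm (hXh.isSmoothField_JField hX) hY, h.normalDeriv_JField_right hX hXh,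
    h.normalDeriv_comm hY hX]

lemma inner_fieldDeriv_normalDeriv (h : S.IsVerticalImmersion φ τ) (hX : IsSmoothField X)
    (hZ : IsSmoothField Z) (hW : IsSmoothField W) (Y : VField m M) (p : M) :
    ⟪fieldDeriv W φ p, fieldDeriv Y (normalDeriv φ X Z) p⟫_ℂ
      = -⟪normalDeriv φ Y W p, normalDeriv φ X Z p⟫_ℂ := by
  have hzero : (fun q ↦ ⟪fieldDeriv W φ q, normalDeriv φ X Z q⟫_ℂ) = fun _ ↦ 0 :=
    funext fun q ↦ inner_normalDeriv_of_mem (fieldDeriv_mem_derivSpan W)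
  have hderiv := mvfderiv_complex_inner_apply
    (mdifferentiableAt_fieldDeriv (hW.mdifferentiableAt p) h.smooth_fst)
    (h.mdifferentiableAt_normalDeriv hX hZ p) (Y p)
  rw [hzero, mvfderiv_const, zero_apply] at hderiv
  rw [h.normalDeriv_eq Y W, inner_sub_left,
    inner_normalDeriv_of_mem (fieldDeriv_mem_derivSpan _), sub_zero, eq_neg_iff_add_eq_zero,
    add_comm]
  exact hderiv.symm

end PseudohermitianStructure.IsVerticalImmersion

namespace PseudohermitianStructure.IsPseudohermitianConnection

variable [T2Space M] {D : AffineConnection m M}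

lemma fieldDeriv_curvature (hD : S.IsPseudohermitianConnection T D) (hT : S.IsReebField T)
    (h : S.IsVerticalImmersion φ τ) (hX : IsSmoothField X) (hY : IsSmoothField Y)
    (hZ : IsSmoothField Z) (hZh : S.IsHorizontal Z) (p : M) :
    fieldDeriv (curvature D X Y Z) φ p = (derivSpan (m := m) φ p).starProjection
      (fieldDeriv Y (normalDeriv φ X Z) p - fieldDeriv X (normalDeriv φ Y Z) p) := by
  have hZφ := fun q ↦ contMDiffAt_fieldDeriv (hZ q) h.smooth_fst
  have fieldDeriv_connection {U : VField m M} (hU : IsSmoothField U) (W : VField m M) :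
      fieldDeriv W (fieldDeriv (fun q ↦ D Z q (U q)) φ) p
        = fieldDeriv W (fieldDeriv U (fieldDeriv Z φ)) p
          - fieldDeriv W (normalDeriv φ U Z) p := by
    have hsub : fieldDeriv (fun q ↦ D Z q (U q)) φ
        = fieldDeriv U (fieldDeriv Z φ) - normalDeriv φ U Z := funext fun q ↦ by
      rw [Pi.sub_apply, normalDeriv, Submodule.starProjection_orthogonal_val, sub_sub_cancel,
        fieldDeriv, hD.mvfderiv_apply hT h hZ hZh]
      rfl
    rw [hsub, fieldDeriv, mvfderiv_sub (mdifferentiableAt_fieldDeriv (hU.mdifferentiableAt p) hZφ)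
      (h.mdifferentiableAt_normalDeriv hU hZ p)]
    rfl
  rw [fieldDeriv, curvature, map_sub, map_sub,
    hD.mvfderiv_apply hT h (hD.smooth Y Z hY hZ) (hD.isHorizontal_apply hZ hZh),
    hD.mvfderiv_apply hT h (hD.smooth X Z hX hZ) (hD.isHorizontal_apply hZ hZh),
    hD.mvfderiv_apply hT h hZ hZh,
    mvfderiv_mlieBracket hZφ (hX.mdifferentiableAt p) (hY.mdifferentiableAt p), ← map_sub,
    ← map_sub]
  refine congrArg _ ?_
  have hYX := fieldDeriv_connection hY X
  have hXY := fieldDeriv_connection hX Y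
  simp only [fieldDeriv] at hYX hXY ⊢
  rw [hYX, hXY]
  abel

lemma levi_curvature (hD : S.IsPseudohermitianConnection T D) (hT : S.IsReebField T)
    (h : S.IsVerticalImmersion φ τ) (hX : IsSmoothField X) (hY : IsSmoothField Y)
    (hZ : IsSmoothField Z) (hZh : S.IsHorizontal Z) (hW : IsSmoothField W)
    (hWh : S.IsHorizontal W) (p : M) :
    S.levi (curvature D X Y Z) W p = ⟪normalDeriv φ X W p, normalDeriv φ Y Z p⟫_ℂ
      - ⟪normalDeriv φ Y W p, normalDeriv φ X Z p⟫_ℂ := by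
  rw [h.levi_eq_inner (hD.isSmoothField_curvature hX hY hZ) hW hWh,
    hD.fieldDeriv_curvature hT h hX hY hZ hZh, ← Submodule.inner_starProjection_left_eq_right,
    Submodule.starProjection_eq_self_iff.2 (fieldDeriv_mem_derivSpan W), inner_sub_right,
    h.inner_fieldDeriv_normalDeriv hX hZ hW, h.inner_fieldDeriv_normalDeriv hY hZ hW]
  ring

theorem websterCurvature_eq (hD : S.IsPseudohermitianConnection T D) (hT : S.IsReebField T)
    (h : S.IsVerticalImmersion φ τ) (hX : IsSmoothField X) (hXh : S.IsHorizontal X)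
    (hY : IsSmoothField Y) (hYh : S.IsHorizontal Y) (hZ : IsSmoothField Z)
    (hZh : S.IsHorizontal Z) (hW : IsSmoothField W) (hWh : S.IsHorizontal W) (p : M) :
    S.websterCurvature D Z W X Y p = -⟪normalDeriv φ Y W p, normalDeriv φ X Z p⟫_ℂ := by
  have hJX := hXh.isSmoothField_JField hX
  have hJY := hYh.isSmoothField_JField hY
  rw [websterCurvature, hD.levi_curvature hT h hX hY hZ hZh hW hWh,
    hD.levi_curvature hT h hJX hJY hZ hZh hW hWh, hD.levi_curvature hT h hX hJY hZ hZh hW hWh,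
    hD.levi_curvature hT h hJX hY hZ hZh hW hWh]
  simp only [h.normalDeriv_JField_left hX hXh hZ, h.normalDeriv_JField_left hX hXh hW,
    h.normalDeriv_JField_left hY hYh hZ, h.normalDeriv_JField_left hY hYh hW, inner_smul_left,
    inner_smul_right, Complex.conj_I]
  linear_combination (1 / 4 * ⟪normalDeriv φ X W p, normalDeriv φ Y Z p⟫_ℂ
    + 3 / 4 * ⟪normalDeriv φ Y W p, normalDeriv φ X Z p⟫_ℂ) * Complex.I_mul_I

lemma websterRicci_self_eq (hD : S.IsPseudohermitianConnection T D) (hT : S.IsReebField T)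
    (h : S.IsVerticalImmersion φ τ) {E : Fin m → VField m M} (hE : S.IsUnitaryFrameAt p E)
    (hX : IsSmoothField X) (hXh : S.IsHorizontal X) :
    S.websterRicci D E X X p = -((∑ k, ‖normalDeriv φ X (E k) p‖ ^ 2 : ℝ) : ℂ) := by
  rw [websterRicci, Complex.ofReal_sum, ← Finset.sum_neg_distrib]
  refine Finset.sum_congr rfl fun k _ ↦ ?_
  rw [hD.websterCurvature_eq hT h hX hXh hX hXh (hE.smooth k) (hE.horizontal k) (hE.smooth k)
    (hE.horizontal k), inner_self_eq_norm_sq_to_K]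
  simp

end PseudohermitianStructure.IsPseudohermitianConnection

end GaussEquation

section Frames

variable {m : ℕ} {M : Type*} [TopologicalSpace M] [ChartedSpace (CRModel m) M]
  [IsManifold (𝓡 (2 * m + 1)) ∞ M] {V : Type*} [NormedAddCommGroup V] [InnerProductSpace ℂ V]
  [NormedSpace ℝ V] [IsScalarTower ℝ ℂ V] {S : PseudohermitianStructure m M}
  {φ : M → V} {τ : M → ℝ} {p : M}

lemma PseudohermitianStructure.IsVerticalImmersion.finrank_derivSpan
    (h : S.IsVerticalImmersion φ τ) (p : M) :
    Module.finrank ℂ (derivSpan (m := m) φ p) = m := by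
  have : FiniteDimensional ℝ (derivSpan (m := m) φ p) := Module.Finite.trans ℂ _
  have hcoords := (h.adaptedCoords p).finrank_eq
  rw [Module.finrank_prod, Module.finrank_self] at hcoords
  have hreal := Module.finrank_mul_finrank ℝ ℂ (derivSpan (m := m) φ p)
  rw [Complex.finrank_real_complex] at hreal
  have hdim : Module.finrank ℝ (TangentSpace (𝓡 (2 * m + 1)) p) = 2 * m + 1 :=
    finrank_euclideanSpace_fin (𝕜 := ℝ)
  lia

lemma PseudohermitianStructure.IsVerticalImmersion.span_eq_derivSpan
    (h : S.IsVerticalImmersion φ τ) {w : Fin m → V} (hli : LinearIndependent ℂ w)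
    (hw : ∀ j, w j ∈ derivSpan (m := m) φ p) :
    Submodule.span ℂ (Set.range w) = derivSpan (m := m) φ p := by
  refine Submodule.eq_of_le_of_finrank_eq (Submodule.span_le.2 (Set.range_subset_iff.2 hw)) ?_
  rw [finrank_span_eq_card hli, Fintype.card_fin, h.finrank_derivSpan]

omit [IsManifold (𝓡 (2 * m + 1)) ∞ M] in
lemma inner_normalDeriv_eq_sum {κ κ' : Type*} [Fintype κ] [Fintype κ']
    (b : OrthonormalBasis (κ ⊕ κ') ℂ V) (hb : ∀ j, b (.inl j) ∈ derivSpan (m := m) φ p)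
    (X Y Z W : VField m M) :
    ⟪normalDeriv φ X Y p, normalDeriv φ Z W p⟫_ℂ = ∑ c, ⟪b (.inr c), normalDeriv φ Z W p⟫_ℂ *
      (starRingEnd ℂ) ⟪b (.inr c), normalDeriv φ X Y p⟫_ℂ := by
  rw [← b.sum_inner_mul_inner, Fintype.sum_sum_type, Finset.sum_eq_zero, zero_add]
  · exact Finset.sum_congr rfl fun c _ ↦ by rw [inner_conj_symm, mul_comm]
  · intro j _
    rw [inner_normalDeriv_of_mem (hb j), mul_zero]

end Frames

section HeisenbergSubmanifold

variable {m n : ℕ} {M : Type*} [TopologicalSpace M] [ChartedSpace (CRModel m) M]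
  [IsManifold (𝓡 (2 * m + 1)) ∞ M] {S : PseudohermitianStructure m M} {ι : M → Heis n} {p : M}

lemma Heis.contactForm_eq_add_im_inner (q v : Heis n) :
    Heis.contactForm q v = v.2 + (⟪q.1, v.1⟫_ℂ).im := by
  simp only [Heis.contactForm, PiLp.inner_apply, RCLike.inner_apply, Complex.im_sum]
  refine congrArg _ (Finset.sum_congr rfl fun β _ ↦ ?_)
  simp only [Complex.mul_im, Complex.conj_re, Complex.conj_im]
  ring

namespace PseudohermitianStructure

namespace IsPseudohermitianSubmanifold

lemma pushforward_fst (hι : S.IsPseudohermitianSubmanifold ι)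
    (v : TangentSpace (𝓡 (2 * m + 1)) p) :
    (pushforward ι p v).1 = mvfderiv (𝓡 (2 * m + 1)) (fun q ↦ (ι q).1) p v :=
  (mvfderiv_comp_apply_of_hasFDerivAt
    (ContinuousLinearMap.fst ℝ (EuclideanSpace ℂ (Fin n)) ℝ).hasFDerivAt
    (hι.smooth.mdifferentiable (by simp) p) v).symm

lemma pushforward_snd (hι : S.IsPseudohermitianSubmanifold ι)
    (v : TangentSpace (𝓡 (2 * m + 1)) p) :
    (pushforward ι p v).2 = mvfderiv (𝓡 (2 * m + 1)) (fun q ↦ (ι q).2) p v :=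
  (mvfderiv_comp_apply_of_hasFDerivAt
    (ContinuousLinearMap.snd ℝ (EuclideanSpace ℂ (Fin n)) ℝ).hasFDerivAt
    (hι.smooth.mdifferentiable (by simp) p) v).symm

lemma pushforward_fst_mem_derivSpan (hι : S.IsPseudohermitianSubmanifold ι)
    (v : TangentSpace (𝓡 (2 * m + 1)) p) :
    (pushforward ι p v).1 ∈ derivSpan (m := m) (fun q ↦ (ι q).1) p :=
  (hι.pushforward_fst v).symm ▸ mvfderiv_mem_derivSpan (φ := fun q ↦ (ι q).1) v

lemma contMDiff_fst (hι : S.IsPseudohermitianSubmanifold ι) :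
    ContMDiff (𝓡 (2 * m + 1)) 𝓘(ℝ, EuclideanSpace ℂ (Fin n)) ∞ fun q ↦ (ι q).1 :=
  (ContinuousLinearMap.fst ℝ (EuclideanSpace ℂ (Fin n)) ℝ).contMDiff.comp hι.smooth

lemma isVerticalImmersion (hι : S.IsPseudohermitianSubmanifold ι) (hν : S.IsVertical ι) :
    S.IsVerticalImmersion (fun q ↦ (ι q).1) (fun q ↦ (ι q).2) where
  smooth_fst := hι.contMDiff_fst
  smooth_snd :=
    (ContinuousLinearMap.snd ℝ (EuclideanSpace ℂ (Fin n)) ℝ).contMDiff.comp hι.smooth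
  θ_eq p v := by
    rw [hι.form, Heis.contactForm_eq_add_im_inner, hι.pushforward_fst, hι.pushforward_snd]
  complex p v hv := by
    rw [← hι.pushforward_fst, hι.complex p v hv, ← hι.pushforward_fst]
    rfl
  immersive p v hv hφ := by
    rw [← hι.pushforward_fst] at hφ
    rw [hι.form, Heis.contactForm_eq_add_im_inner, hφ, inner_zero_right, Complex.zero_im,
      add_zero] at hv
    exact hι.immersion p (by rw [map_zero]; exact Prod.ext hφ hv)
  exists_transverse p := by
    obtain ⟨v, hv⟩ := hν.tangent p
    rw [add_zero] at hv
    refine ⟨v, ?_, ?_⟩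
    · rw [hι.form, hv, Heis.contactForm_eq_add_im_inner]
      simp [Heis.T]
    · rw [← hι.pushforward_fst, hv]
      rfl

lemma heisDeriv_fst (hι : S.IsPseudohermitianSubmanifold ι) {Y : VField m M}
    (hY : IsSmoothField Y) (p : M) (v : TangentSpace (𝓡 (2 * m + 1)) p) :
    (heisDeriv ι (fun q ↦ pushforward ι q (Y q)) p v).1
      = mvfderiv (𝓡 (2 * m + 1)) (fieldDeriv Y fun q ↦ (ι q).1) p v := by
  have hcoeff : (fun q ↦ Heis.coeff (ι q) (pushforward ι q (Y q)))
      = fun q ↦ (fieldDeriv Y (fun q ↦ (ι q).1) q, S.θ q (Y q)) := by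
    funext q
    rw [Heis.coeff, ← hι.form, hι.pushforward_fst]
    rfl
  rw [heisDeriv, hcoeff]
  exact (mvfderiv_comp_apply_of_hasFDerivAt
    (ContinuousLinearMap.fst ℝ (EuclideanSpace ℂ (Fin n)) ℝ).hasFDerivAt
    ((mdifferentiableAt_fieldDeriv (hY.mdifferentiableAt p) hι.contMDiff_fst).prodMk_space
      ((S.smooth_θ Y hY).mdifferentiable (by simp) p)) v).symm

lemma mem_contactSubspace_iff (hι : S.IsPseudohermitianSubmanifold ι) (hν : S.IsVertical ι)
    {w : EuclideanSpace ℂ (Fin n)} :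
    w ∈ S.contactSubspace ι p ↔ w ∈ derivSpan (m := m) (fun q ↦ (ι q).1) p := by
  constructor
  · rintro ⟨v, -, rfl⟩
    exact hι.pushforward_fst_mem_derivSpan v
  · intro hw
    obtain ⟨v, hv, rfl⟩ := (hι.isVerticalImmersion hν).exists_eq hw 0
    exact ⟨v, hv, hι.pushforward_fst v⟩

lemma starProjection_contactSubspace (hι : S.IsPseudohermitianSubmanifold ι)
    (hν : S.IsVertical ι) (w : EuclideanSpace ℂ (Fin n)) :
    (S.contactSubspace ι p).starProjection w
      = (derivSpan (m := m) (fun q ↦ (ι q).1) p).starProjection w := by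
  refine (Submodule.eq_starProjection_of_mem_of_inner_eq_zero
    ((hι.mem_contactSubspace_iff hν).2 (Submodule.starProjection_apply_mem _ _))
    fun u hu ↦ ?_)
  have real_inner (x y : EuclideanSpace ℂ (Fin n)) : ⟪x, y⟫_ℝ = (⟪x, y⟫_ℂ).re := by
    simp [PiLp.inner_apply]
  rw [real_inner, Submodule.starProjection_inner_eq_zero w u
    ((hι.mem_contactSubspace_iff hν).1 hu), Complex.zero_re]

theorem pushforward_eq_tangentialDeriv [T2Space M] (hι : S.IsPseudohermitianSubmanifold ι)
    (hν : S.IsVertical ι) {T : VField m M} {D : AffineConnection m M} (hT : S.IsReebField T)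
    (hD : S.IsPseudohermitianConnection T D) {Y : VField m M} (hY : IsSmoothField Y)
    (hYh : S.IsHorizontal Y) (p : M) (v : TangentSpace (𝓡 (2 * m + 1)) p) :
    pushforward ι p (D Y p v) = S.tangentialDeriv ι Y p v := by
  rw [← Heis.frame_coeff (ι p) (pushforward ι p (D Y p v)), Heis.coeff, ← hι.form,
    hD.horizontal Y hY hYh, hι.pushforward_fst,
    hD.mvfderiv_apply hT (hι.isVerticalImmersion hν) hY hYh, tangentialDeriv,
    hι.heisDeriv_fst hY, hι.starProjection_contactSubspace hν]

lemma secondFundamentalForm_eq_inner (hι : S.IsPseudohermitianSubmanifold ι)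
    (hν : S.IsVertical ι) {X Y : VField m M} (hX : IsSmoothField X) (hY : IsSmoothField Y)
    (hYh : S.IsHorizontal Y) {N : EuclideanSpace ℂ (Fin n)}
    (hN : N ∈ (derivSpan (m := m) (fun q ↦ (ι q).1) p)ᗮ) :
    S.secondFundamentalForm ι N X Y p = ⟪N, normalDeriv (fun q ↦ (ι q).1) Y X p⟫_ℂ := by
  have connectionForm_eq (Z : VField m M) :
      connectionForm ι N X p (Z p) = ⟪N, normalDeriv (fun q ↦ (ι q).1) Z X p⟫_ℂ := by
    rw [connectionForm, hι.heisDeriv_fst hX, normalDeriv,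
      ← Submodule.inner_starProjection_left_eq_right, Submodule.starProjection_eq_self_iff.2 hN]
    rfl
  have hJ : connectionForm ι N X p (S.J p (Y p)) = _ := connectionForm_eq (S.JField Y)
  rw [secondFundamentalForm, connectionForm_eq, hJ,
    (hι.isVerticalImmersion hν).normalDeriv_JField_left hY hYh hX, inner_smul_right, ← mul_assoc,
    Complex.I_mul_I]
  ring

end IsPseudohermitianSubmanifold

namespace IsDarbouxFrameAt

variable {E : Fin m → VField m M} {N : Fin (n - m) → EuclideanSpace ℂ (Fin n)}

lemma exists_orthonormalBasis (hE : S.IsDarbouxFrameAt ι p E N) :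
    ∃ b : OrthonormalBasis (Fin m ⊕ Fin (n - m)) ℂ (EuclideanSpace ℂ (Fin n)),
      ⇑b = Sum.elim (fun j ↦ (pushforward ι p (E j p)).1) N := by
  have hli := hE.unitary.linearIndependent
  have hle := hli.fintype_card_le_finrank
  have hcard : Fintype.card (Fin m ⊕ Fin (n - m))
      = Module.finrank ℂ (EuclideanSpace ℂ (Fin n)) := by
    simp only [Fintype.card_sum, Fintype.card_fin, finrank_euclideanSpace] at hle ⊢
    lia
  exact ⟨.mk hE.unitary (hli.span_eq_top_of_card_eq_finrank' hcard).ge,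
    OrthonormalBasis.coe_mk _ _⟩

lemma normal_mem_orthogonal (hE : S.IsDarbouxFrameAt ι p E N)
    (hι : S.IsPseudohermitianSubmanifold ι) (hν : S.IsVertical ι) (c : Fin (n - m)) :
    N c ∈ (derivSpan (m := m) (fun q ↦ (ι q).1) p)ᗮ := by
  rw [← (hι.isVerticalImmersion hν).span_eq_derivSpan
    (hE.unitary.linearIndependent.comp _ Sum.inl_injective)
    fun j ↦ hι.pushforward_fst_mem_derivSpan (E j p), ← Submodule.span_singleton_le_iff_mem,
    ← Submodule.IsOrtho, Submodule.isOrtho_span]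
  rintro _ rfl _ ⟨j, rfl⟩
  exact hE.unitary.inner_eq_zero (i := .inr c) (j := .inl j) (by simp)

theorem websterCurvature_eq [T2Space M] (hE : S.IsDarbouxFrameAt ι p E N)
    (hι : S.IsPseudohermitianSubmanifold ι) (hν : S.IsVertical ι) {T : VField m M}
    {D : AffineConnection m M} (hT : S.IsReebField T) (hD : S.IsPseudohermitianConnection T D)
    (j l ζ η : Fin m) :
    S.websterCurvature D (E j) (E l) (E ζ) (E η) p =
      -∑ c, S.secondFundamentalForm ι (N c) (E j) (E ζ) p *
        (starRingEnd ℂ) (S.secondFundamentalForm ι (N c) (E l) (E η) p) := by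
  have hs := hE.smooth
  have hh := hE.horizontal
  obtain ⟨b, hb⟩ := hE.exists_orthonormalBasis
  have hbE (k : Fin m) : b (.inl k) ∈ derivSpan (m := m) (fun q ↦ (ι q).1) p :=
    hb ▸ hι.pushforward_fst_mem_derivSpan (E k p)
  have second_eq (i k : Fin m) (c : Fin (n - m)) :=
    hι.secondFundamentalForm_eq_inner hν (hs i) (hs k) (hh k)
      (hE.normal_mem_orthogonal hι hν c)
  rw [hD.websterCurvature_eq hT (hι.isVerticalImmersion hν) (hs ζ) (hh ζ) (hs η) (hh η) (hs j)
    (hh j) (hs l) (hh l), inner_normalDeriv_eq_sum b hbE]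
  simp only [hb, Sum.elim_inr, second_eq]

theorem websterRicci_eq [T2Space M] (hE : S.IsDarbouxFrameAt ι p E N)
    (hι : S.IsPseudohermitianSubmanifold ι) (hν : S.IsVertical ι) {T : VField m M}
    {D : AffineConnection m M} (hT : S.IsReebField T) (hD : S.IsPseudohermitianConnection T D)
    (ζ η : Fin m) :
    S.websterRicci D E (E ζ) (E η) p =
      -∑ c, ∑ k, S.secondFundamentalForm ι (N c) (E k) (E ζ) p *
        (starRingEnd ℂ) (S.secondFundamentalForm ι (N c) (E k) (E η) p) := by
  rw [Finset.sum_comm, websterRicci, ← Finset.sum_neg_distrib]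
  exact Finset.sum_congr rfl fun k _ ↦ hE.websterCurvature_eq hι hν hT hD k k ζ η

end IsDarbouxFrameAt

end PseudohermitianStructure

end HeisenbergSubmanifold

theorem theoremE (m n : ℕ) (hm : 1 ≤ m) (M : Type*) [TopologicalSpace M] [T2Space M]
    [ChartedSpace (CRModel m) M] [IsManifold (𝓡 (2 * m + 1)) ∞ M]
    (S : PseudohermitianStructure m M) (ι : M → Heis n)
    (hι : S.IsPseudohermitianSubmanifold ι) (hν : S.IsVertical ι) :
    (∃ (T : VField m M) (D : AffineConnection m M),
      S.IsReebField T ∧ S.IsPseudohermitianConnection T D) ∧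
    ∀ (T : VField m M) (D : AffineConnection m M),
      S.IsReebField T → S.IsPseudohermitianConnection T D →
      -- the Webster torsion vanishes
      (∀ p v, D.torsion p (T p) v = 0) ∧
      -- the pseudohermitian connection is the tangential connection
      (∀ Y : VField m M, IsSmoothField Y → S.IsHorizontal Y →
        ∀ p v, pushforward ι p (D Y p v) = S.tangentialDeriv ι Y p v) ∧
      -- the Gauss-like equation and the formula for the Webster-Ricci tensor
      (∀ p E N, S.IsDarbouxFrameAt ι p E N →
        (∀ j l ζ η, S.websterCurvature D (E j) (E l) (E ζ) (E η) p =
          -∑ c, S.secondFundamentalForm ι (N c) (E j) (E ζ) p *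
            (starRingEnd ℂ) (S.secondFundamentalForm ι (N c) (E l) (E η) p)) ∧
        (∀ ζ η, S.websterRicci D E (E ζ) (E η) p =
          -∑ c, ∑ k, S.secondFundamentalForm ι (N c) (E k) (E ζ) p *
            (starRingEnd ℂ) (S.secondFundamentalForm ι (N c) (E k) (E η) p))) ∧
      -- the Webster-Ricci tensor is non-positive
      (∀ p E, S.IsUnitaryFrameAt p E → ∀ X : VField m M, IsSmoothField X → S.IsHorizontal X →
        (S.websterRicci D E X X p).im = 0 ∧ (S.websterRicci D E X X p).re ≤ 0) := by
  have h := hι.isVerticalImmersion hν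
  obtain ⟨T₀, hT₀⟩ := h.exists_isReebField
  refine ⟨⟨T₀, h.connection, hT₀, h.isPseudohermitianConnection_connection hT₀⟩,
    fun T D hT hD ↦ ⟨hD.torsion_reeb_eq_zero hT h,
      fun Y hY hYh ↦ hι.pushforward_eq_tangentialDeriv hν hT hD hY hYh,
      fun p E N hE ↦ ⟨hE.websterCurvature_eq hι hν hT hD, hE.websterRicci_eq hι hν hT hD⟩,
      fun p E hE X hX hXh ↦ ?_⟩⟩
  rw [hD.websterRicci_self_eq hT h hE hX hXh, ← Complex.ofReal_neg]
  exact ⟨Complex.ofReal_im _, neg_nonpos.2 (Finset.sum_nonneg fun k _ ↦ sq_nonneg _)⟩
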